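/- Let $r,s\in\mathbb C^*$ be such that $r^m s^n=1$ with $m,n\in\mathbb Z$ implies $m=n=0$. Let $\check U=\check U_{r,s}^{\geq 0}(G_2)$ be (the underlying algebra of) the augmented two-parameter Hopf algebra, that is, the unital associative $\mathbb C$-algebra generated by $e_1,e_2,k_1^{\pm1},k_2^{\pm1}$ subject to the relations $$k_ik_i^{-1}=k_i^{-1}k_i=1\ (i=1,2),\qquad k_1k_2=k_2k_1,$$ $$k_1e_1=r^{-1}s^{-2}e_1k_1,\quad k_1e_2=r^3s^3e_2k_1,\quad k_2e_1=r^{-3}s^{-3}e_1k_2,\quad k_2e_2=r^6s^3e_2k_2,$$ $$e_2^2e_1-(r^{-3}+s^{-3})e_2e_1e_2+r^{-3}s^{-3}e_1e_2^2=0,$$ $$e_1^4e_2-(r+s)(r^2+s^2)e_1^3e_2e_1+rs(r^2+s^2)(r^2+rs+s^2)e_1^2e_2e_1^2-r^3s^3(r+s)(r^2+s^2)e_1e_2e_1^3+r^6s^6e_2e_1^4=0.$$ Let $\theta$ be a $\mathbb C$-algebra automorphism of $\check U$. Then there are $\lambda_1,\lambda_2,\gamma_1,\gamma_2\in\mathbb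 C^*$ and $a,b,c,d\in\mathbb Z$ with $c=3b$ and $a+3b+d=0$ such that $$\theta(k_1)=\lambda_1k_1,\quad \theta(k_2)=\lambda_2k_2,\quad \theta(e_1)=\gamma_1k_1^ak_2^be_1,\quad \theta(e_2)=\gamma_2k_1^ck_2^de_2.$$ -/

import Mathlib

namespace TwoParamG2

/-- The letters `e₁, e₂, k₁, k₁⁻¹, k₂, k₂⁻¹`. -/
inductive Gen : Type
  | e1 | e2 | k1 | k1inv | k2 | k2inv

/-- A letter as an element of the free algebra. -/
abbrev gen (x : Gen) : FreeAlgebra ℂ Gen := FreeAlgebra.ι ℂ x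

open Gen in
/-- The defining relations: `k₁, k₂` are invertible and commute, the commutation rules of
`k₁, k₂` with `e₁, e₂`, and the two quantum Serre relations of type `G₂`. -/
inductive Rel (r s : ℂ) : FreeAlgebra ℂ Gen → FreeAlgebra ℂ Gen → Prop
  | k1_mul_inv : Rel r s (gen k1 * gen k1inv) 1
  | k1_inv_mul : Rel r s (gen k1inv * gen k1) 1
  | k2_mul_inv : Rel r s (gen k2 * gen k2inv) 1
  | k2_inv_mul : Rel r s (gen k2inv * gen k2) 1
  | k1_k2 : Rel r s (gen k1 * gen k2) (gen k2 * gen k1)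
  | k1_e1 : Rel r s (gen k1 * gen e1) ((r ^ (-1 : ℤ) * s ^ (-2 : ℤ)) • (gen e1 * gen k1))
  | k1_e2 : Rel r s (gen k1 * gen e2) ((r ^ 3 * s ^ 3) • (gen e2 * gen k1))
  | k2_e1 : Rel r s (gen k2 * gen e1) ((r ^ (-3 : ℤ) * s ^ (-3 : ℤ)) • (gen e1 * gen k2))
  | k2_e2 : Rel r s (gen k2 * gen e2) ((r ^ 6 * s ^ 3) • (gen e2 * gen k2))
  | serre_e2 : Rel r s
      (gen e2 ^ 2 * gen e1
        - (r ^ (-3 : ℤ) + s ^ (-3 : ℤ)) • (gen e2 * gen e1 * gen e2)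
        + (r ^ (-3 : ℤ) * s ^ (-3 : ℤ)) • (gen e1 * gen e2 ^ 2)) 0
  | serre_e1 : Rel r s
      (gen e1 ^ 4 * gen e2
        - ((r + s) * (r ^ 2 + s ^ 2)) • (gen e1 ^ 3 * gen e2 * gen e1)
        + (r * s * (r ^ 2 + s ^ 2) * (r ^ 2 + r * s + s ^ 2)) •
            (gen e1 ^ 2 * gen e2 * gen e1 ^ 2)
        - (r ^ 3 * s ^ 3 * (r + s) * (r ^ 2 + s ^ 2)) • (gen e1 * gen e2 * gen e1 ^ 3)
        + (r ^ 6 * s ^ 6) • (gen e2 * gen e1 ^ 4)) 0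

/-- The underlying `ℂ`-algebra of the augmented two-parameter Hopf algebra
`Ǔ_{r,s}^{≥0}(G₂)`, by generators and relations. -/
def AugBorel (r s : ℂ) : Type := RingQuot (Rel r s)

instance (r s : ℂ) : Ring (AugBorel r s) := inferInstanceAs (Ring (RingQuot (Rel r s)))

instance (r s : ℂ) : Algebra ℂ (AugBorel r s) :=
  inferInstanceAs (Algebra ℂ (RingQuot (Rel r s)))

/-- The quotient map from the free algebra. -/
def mk (r s : ℂ) : FreeAlgebra ℂ Gen →ₐ[ℂ] AugBorel r s := RingQuot.mkAlgHom ℂ (Rel r s)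

theorem mk_rel {r s : ℂ} {x y : FreeAlgebra ℂ Gen} (h : Rel r s x y) :
    mk r s x = mk r s y :=
  RingQuot.mkAlgHom_rel ℂ h

/-- The generator `e₁`. -/
def e₁ (r s : ℂ) : AugBorel r s := mk r s (gen Gen.e1)

/-- The generator `e₂`. -/
def e₂ (r s : ℂ) : AugBorel r s := mk r s (gen Gen.e2)

/-- The generator `k₁`, as a unit, so that its integer powers make sense. -/
def k₁ (r s : ℂ) : (AugBorel r s)ˣ where
  val := mk r s (gen Gen.k1)
  inv := mk r s (gen Gen.k1inv)
  val_inv := by rw [← map_mul, mk_rel Rel.k1_mul_inv, map_one]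
  inv_val := by rw [← map_mul, mk_rel Rel.k1_inv_mul, map_one]

/-- The generator `k₂`, as a unit, so that its integer powers make sense. -/
def k₂ (r s : ℂ) : (AugBorel r s)ˣ where
  val := mk r s (gen Gen.k2)
  inv := mk r s (gen Gen.k2inv)
  val_inv := by rw [← map_mul, mk_rel Rel.k2_mul_inv, map_one]
  inv_val := by rw [← map_mul, mk_rel Rel.k2_inv_mul, map_one]

end TwoParamG2

/-! An automorphism preserves units, so the proof rests on knowing that the units are the scalar
multiples of the torus monomials `k₁ ^ i * k₂ ^ j` (`eq_smul_torusMon_of_mul_eq_one`). This uses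
that the algebra is a domain, which comes from a PBW basis. Straightening relations between root
vectors show that the ordered monomials span (`span_pbw`). A Feigin-type homomorphism sends `e₁`,
`e₂` to x₁ + x₃ + x₅ and x₂ + x₄ + x₆ in a quantum torus, where the ordered monomials have distinct
leading exponents. Hence they are linearly independent (`linearIndependent_pbw`) and there are no
zero divisors (`noZeroDivisors`). The grading by height then confines units to the torus subalgebra,
a Laurent polynomial ring.

So θ(k₁) and θ(k₂) are multiples of torus monomials. To identify them, use a triangular
two-dimensional representation that kills `e₁` but not `e₂`. As θ is onto, the image under θ of some
generator has a nonzero off-diagonal entry. A congruence modulo 3 excludes `e₁`, the torus is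
excluded by commutativity, and the remaining generator `e₂` determines the two monomials
(`torusMon_eq_of_algEquiv`).

Therefore θ preserves weights for `k₁`. The only ordered monomials of weight αᵢ are eᵢ times a torus
monomial, so θ(eᵢ) lies in eᵢ times the algebra. The same holds for θ⁻¹, which makes the cofactor a
unit, that is, a multiple of a torus monomial. Finally the Serre relation quadratic in `e₂`, applied
to the twisted generators, forces two character values to agree (`chi_eq_of_serrePair`). Comparing
exponents of r and s gives the two linear conditions. -/

namespace TwoParamG2

/-! ### Universal property: maps out of the algebra from pairs satisfying the relations -/

/-- The two quantum Serre relations of type `G₂` for a pair of elements of an algebra. -/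
structure SerrePair (r s : ℂ) {A : Type*} [Ring A] [Algebra ℂ A] (a b : A) : Prop where
  serre_b : b ^ 2 * a - (r ^ (-3 : ℤ) + s ^ (-3 : ℤ)) • (b * a * b)
    + (r ^ (-3 : ℤ) * s ^ (-3 : ℤ)) • (a * b ^ 2) = 0
  serre_a : a ^ 4 * b
    - ((r + s) * (r ^ 2 + s ^ 2)) • (a ^ 3 * b * a)
    + (r * s * (r ^ 2 + s ^ 2) * (r ^ 2 + r * s + s ^ 2)) • (a ^ 2 * b * a ^ 2)
    - (r ^ 3 * s ^ 3 * (r + s) * (r ^ 2 + s ^ 2)) • (a * b * a ^ 3)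
    + (r ^ 6 * s ^ 6) • (b * a ^ 4) = 0

/-- Two commuting units acting on a pair of elements by the defining characters. -/
structure TorusAction (r s : ℂ) {A : Type*} [Ring A] [Algebra ℂ A] (a b : A) (k l : Aˣ) :
    Prop where
  comm : (k : A) * l = l * k
  k_a : (k : A) * a = (r ^ (-1 : ℤ) * s ^ (-2 : ℤ)) • (a * k)
  k_b : (k : A) * b = (r ^ 3 * s ^ 3) • (b * k)
  l_a : (l : A) * a = (r ^ (-3 : ℤ) * s ^ (-3 : ℤ)) • (a * l)
  l_b : (l : A) * b = (r ^ 6 * s ^ 3) • (b * l)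

section Lift

variable {r s : ℂ} {A : Type*} [Ring A] [Algebra ℂ A]

/-- The values of a homomorphism on the letters. -/
def genVal (a b : A) (k l : Aˣ) : Gen → A
  | .e1 => a
  | .e2 => b
  | .k1 => k
  | .k1inv => (k⁻¹ : Aˣ)
  | .k2 => l
  | .k2inv => (l⁻¹ : Aˣ)

theorem lift_rel {a b : A} {k l : Aˣ} (hS : SerrePair r s a b) (hT : TorusAction r s a b k l)
    ⦃x y : FreeAlgebra ℂ Gen⦄ (h : Rel r s x y) :
    FreeAlgebra.lift ℂ (genVal a b k l) x = FreeAlgebra.lift ℂ (genVal a b k l) y := by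
  cases h <;> simp only [gen, map_mul, map_add, map_sub, map_smul, map_pow, map_one, map_zero,
    FreeAlgebra.lift_ι_apply, genVal, Units.mul_inv, Units.inv_mul]
  · exact hT.comm
  · exact hT.k_a
  · exact hT.k_b
  · exact hT.l_a
  · exact hT.l_b
  · exact hS.serre_b
  · exact hS.serre_a

/-- The universal property of `AugBorel`. -/
def lift {a b : A} {k l : Aˣ} (hS : SerrePair r s a b) (hT : TorusAction r s a b k l) :
    AugBorel r s →ₐ[ℂ] A :=
  RingQuot.liftAlgHom ℂ ⟨FreeAlgebra.lift ℂ (genVal a b k l), lift_rel hS hT⟩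

theorem lift_mk {a b : A} {k l : Aˣ} (hS : SerrePair r s a b) (hT : TorusAction r s a b k l)
    (x : FreeAlgebra ℂ Gen) :
    lift hS hT (mk r s x) = FreeAlgebra.lift ℂ (genVal a b k l) x :=
  RingQuot.liftAlgHom_mkAlgHom_apply ℂ _ _ _

variable {a b : A} {k l : Aˣ} (hS : SerrePair r s a b) (hT : TorusAction r s a b k l)

@[simp] theorem lift_e₁ : lift hS hT (e₁ r s) = a := by
  simp [e₁, lift_mk, gen, genVal]

@[simp] theorem lift_e₂ : lift hS hT (e₂ r s) = b := by
  simp [e₂, lift_mk, gen, genVal]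

@[simp] theorem lift_k₁ : lift hS hT (k₁ r s : AugBorel r s) = k := by
  simp [k₁, lift_mk, gen, genVal]

@[simp] theorem lift_k₂ : lift hS hT (k₂ r s : AugBorel r s) = l := by
  simp [k₂, lift_mk, gen, genVal]

end Lift

variable (r s : ℂ)

theorem serrePair : SerrePair r s (e₁ r s) (e₂ r s) where
  serre_b := by
    have := mk_rel (Rel.serre_e2 (r := r) (s := s))
    simp only [map_mul, map_add, map_sub, map_smul, map_pow, map_zero] at this
    exact this
  serre_a := by
    have := mk_rel (Rel.serre_e1 (r := r) (s := s))
    simp only [map_mul, map_add, map_sub, map_smul, map_pow, map_zero] at this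
    exact this

theorem torusAction : TorusAction r s (e₁ r s) (e₂ r s) (k₁ r s) (k₂ r s) where
  comm := by
    have := mk_rel (Rel.k1_k2 (r := r) (s := s))
    simp only [map_mul] at this
    exact this
  k_a := by
    have := mk_rel (Rel.k1_e1 (r := r) (s := s))
    simp only [map_mul, map_smul] at this
    exact this
  k_b := by
    have := mk_rel (Rel.k1_e2 (r := r) (s := s))
    simp only [map_mul, map_smul] at this
    exact this
  l_a := by
    have := mk_rel (Rel.k2_e1 (r := r) (s := s))
    simp only [map_mul, map_smul] at this
    exact this
  l_b := by
    have := mk_rel (Rel.k2_e2 (r := r) (s := s))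
    simp only [map_mul, map_smul] at this
    exact this

variable {r s}

theorem subalgebra_eq_top {B : Subalgebra ℂ (AugBorel r s)} (h₁ : e₁ r s ∈ B) (h₂ : e₂ r s ∈ B)
    (hk : (k₁ r s : AugBorel r s) ∈ B) (hk' : (((k₁ r s)⁻¹ : (AugBorel r s)ˣ) : AugBorel r s) ∈ B)
    (hl : (k₂ r s : AugBorel r s) ∈ B) (hl' : (((k₂ r s)⁻¹ : (AugBorel r s)ˣ) : AugBorel r s) ∈ B) :
    B = ⊤ := by
  refine eq_top_iff.2 fun x _ => ?_
  obtain ⟨y, rfl⟩ := RingQuot.mkAlgHom_surjective ℂ (Rel r s) x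
  induction y using FreeAlgebra.induction with
  | grade0 c => rw [AlgHom.commutes]; exact B.algebraMap_mem c
  | grade1 g => cases g <;> assumption
  | mul x y hx hy => rw [map_mul]; exact B.mul_mem (hx trivial) (hy trivial)
  | add x y hx hy => rw [map_add]; exact B.add_mem (hx trivial) (hy trivial)


/-! ### Root vectors and their straightening relations -/

section RootVectors

/-- The root vector of weight `α₁ + α₂`. -/
noncomputable def rootV11 (s : ℂ) {A : Type*} [Ring A] [Algebra ℂ A] (a b : A) : A :=
  a * b - s ^ 3 • (b * a)

/-- The root vector of weight `2α₁ + α₂`. -/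
noncomputable def rootV21 (r s : ℂ) {A : Type*} [Ring A] [Algebra ℂ A] (a b : A) : A :=
  a * rootV11 s a b - (r * s ^ 2) • (rootV11 s a b * a)

/-- The root vector of weight `3α₁ + α₂`. -/
noncomputable def rootV31 (r s : ℂ) {A : Type*} [Ring A] [Algebra ℂ A] (a b : A) : A :=
  a * rootV21 r s a b - (r ^ 2 * s) • (rootV21 r s a b * a)

/-- The root vector of weight `3α₁ + 2α₂`. -/
noncomputable def rootV32 (r s : ℂ) {A : Type*} [Ring A] [Algebra ℂ A] (a b : A) : A :=
  rootV11 s a b * rootV21 r s a b - (r ^ 3)⁻¹ • (rootV21 r s a b * rootV11 s a b)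

variable {r s : ℂ} {A : Type*} [Ring A] [Algebra ℂ A] {a b : A}

theorem a_mul_b : a * b = rootV11 s a b + s ^ 3 • (b * a) := by
  rw [rootV11]; abel

theorem a_mul_rootV11 :
    a * rootV11 s a b = rootV21 r s a b + (r * s ^ 2) • (rootV11 s a b * a) := by
  rw [rootV21]; abel

theorem a_mul_rootV21 :
    a * rootV21 r s a b = rootV31 r s a b + (r ^ 2 * s) • (rootV21 r s a b * a) := by
  rw [rootV31]; abel

theorem mul_mul_of_eq {M : Type*} [Semigroup M] {x y w : M} (h : x * y = w) (z : M) :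
    x * (y * z) = w * z := by
  rw [← mul_assoc, h]

namespace SerrePair

/-- With L and R the left and right multiplications by a, which commute, the quartic Serre relation
is the product of the factors L − cR, for c = s³, rs², r²s, r³, applied to b. The root vectors are
the partial products, and the last factor remains. -/
theorem a_mul_rootV31 (h : SerrePair r s a b) :
    a * rootV31 r s a b = r ^ 3 • (rootV31 r s a b * a) := by
  have := h.serre_a
  simp only [rootV31, rootV21, rootV11, pow_succ, pow_zero, one_mul, mul_sub, sub_mul,
    mul_smul_comm, smul_mul_assoc, smul_sub, mul_assoc] at this ⊢
  linear_combination (norm := module) (1 : ℂ) • this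

variable (hr : r ≠ 0) (hs : s ≠ 0) (h : SerrePair r s a b)

include hr hs h

/-- The quadratic Serre relation factors in the same way for b, with roots r⁻³ and s⁻³. The root s⁻³
gives `rootV11` up to a scalar. -/
theorem b_mul_rootV11 : b * rootV11 s a b = (r ^ 3)⁻¹ • (rootV11 s a b * b) := by
  have := h.serre_b
  simp only [rootV11, pow_succ, pow_zero, one_mul, mul_sub, sub_mul, mul_smul_comm,
    smul_mul_assoc, smul_sub, mul_assoc] at this ⊢
  linear_combination (norm := skip) (-s ^ 3 : ℂ) • this
  match_scalars <;> field_simp <;> ring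

/-- Twisted commutation with a is a skew derivation raising each root vector to the next. Applying
it to the previous relation gives this one; the later relations with `rootV31` arise likewise, the
twist being the product of those of the two factors. -/
theorem b_mul_rootV21 : b * rootV21 r s a b = ((r * s) ^ 3)⁻¹ • (rootV21 r s a b * b) +
    ((s ^ 2 - r ^ 2) / (r ^ 2 * s ^ 3)) • (rootV11 s a b * rootV11 s a b) := by
  have h₀ := h.b_mul_rootV11 hr hs
  have h₁ := congrArg (a * ·) h₀
  have h₂ := congrArg (· * a) h₀
  have ab := a_mul_b (s := s) (a := a) (b := b)
  have a11 := a_mul_rootV11 (r := r) (s := s) (a := a) (b := b)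
  simp only [ab, mul_mul_of_eq ab, a11, mul_mul_of_eq a11,
    mul_smul_comm, smul_mul_assoc, mul_add (R := A), add_mul (R := A), mul_assoc (G := A)] at h₁ h₂
  linear_combination (norm := skip) (s ^ 3)⁻¹ • h₁ - (s ^ 3)⁻¹ • (r * s ^ 5) • h₂
  match_scalars <;> field_simp <;> ring

theorem b_mul_rootV31 : b * rootV31 r s a b = (r ^ 3 * s ^ 6)⁻¹ • (rootV31 r s a b * b) +
    ((r * s + s ^ 2 - r ^ 2) / (r ^ 2 * s ^ 6)) • (rootV21 r s a b * rootV11 s a b) +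
    ((s ^ 2 - r ^ 2 - r * s) / (r * s ^ 4)) • (rootV11 s a b * rootV21 r s a b) := by
  have h₀ := h.b_mul_rootV21 hr hs
  have h₁ := congrArg (a * ·) h₀
  have h₂ := congrArg (· * a) h₀
  have ab := a_mul_b (s := s) (a := a) (b := b)
  have a11 := a_mul_rootV11 (r := r) (s := s) (a := a) (b := b)
  have a21 := a_mul_rootV21 (r := r) (s := s) (a := a) (b := b)
  simp only [ab, mul_mul_of_eq ab, a11, mul_mul_of_eq a11, a21, mul_mul_of_eq a21,
    mul_smul_comm, smul_mul_assoc, mul_add (R := A), add_mul (R := A), mul_assoc (G := A)] at h₁ h₂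
  linear_combination (norm := skip) (s ^ 3)⁻¹ • h₁ - (r ^ 2 * s) • h₂
  match_scalars <;> field_simp <;> ring

theorem rootV11_mul_rootV31 (hrs : r + s ≠ 0) :
    rootV11 s a b * rootV31 r s a b = ((r * s) ^ 3)⁻¹ • (rootV31 r s a b * rootV11 s a b) +
    ((s ^ 3 - r ^ 3) / (r ^ 2 * s ^ 3 * (r + s))) • (rootV21 r s a b * rootV21 r s a b) := by
  have h₀ := h.b_mul_rootV31 hr hs
  have h₁ := congrArg (a * ·) h₀
  have h₂ := congrArg (· * a) h₀
  have ab := a_mul_b (s := s) (a := a) (b := b)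
  have a11 := a_mul_rootV11 (r := r) (s := s) (a := a) (b := b)
  have a21 := a_mul_rootV21 (r := r) (s := s) (a := a) (b := b)
  have a31 := h.a_mul_rootV31
  simp only [ab, mul_mul_of_eq ab, a11, mul_mul_of_eq a11, a21, mul_mul_of_eq a21, a31, mul_mul_of_eq a31,
    mul_smul_comm, smul_mul_assoc, mul_add (R := A), add_mul (R := A), mul_assoc (G := A)] at h₁ h₂
  linear_combination (norm := skip) (s ^ 2 / (r * (r + s))) • (h₁ - (r * s) ^ 3 • h₂)
  match_scalars <;> field_simp <;> ring

theorem rootV21_mul_rootV31 (hrs : r + s ≠ 0) (hrs' : r ^ 2 + s ^ 2 ≠ 0) :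
    rootV21 r s a b * rootV31 r s a b = (r ^ 3)⁻¹ • (rootV31 r s a b * rootV21 r s a b) := by
  have h₀ := h.rootV11_mul_rootV31 hr hs hrs
  have h₁ := congrArg (a * ·) h₀
  have h₂ := congrArg (· * a) h₀
  have a11 := a_mul_rootV11 (r := r) (s := s) (a := a) (b := b)
  have a21 := a_mul_rootV21 (r := r) (s := s) (a := a) (b := b)
  have a31 := h.a_mul_rootV31
  simp only [a11, mul_mul_of_eq a11, a21, mul_mul_of_eq a21, a31, mul_mul_of_eq a31,
    mul_smul_comm, smul_mul_assoc, mul_add (R := A), add_mul (R := A), mul_assoc (G := A)] at h₁ h₂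
  linear_combination (norm := skip) (s ^ 2 * (r + s) / (r * (r ^ 2 + s ^ 2))) • (h₁ - (r ^ 4 * s ^ 2) • h₂)
  match_scalars <;> field_simp <;> ring

theorem b_mul_rootV32 :
    b * rootV32 r s a b = (r ^ 6 * s ^ 3)⁻¹ • (rootV32 r s a b * b) := by
  have b11 := h.b_mul_rootV11 hr hs
  have b21 := h.b_mul_rootV21 hr hs
  simp only [rootV32, b11, mul_mul_of_eq b11, b21, mul_mul_of_eq b21,
    mul_smul_comm, smul_mul_assoc, mul_add (R := A), add_mul (R := A), mul_assoc (G := A), mul_sub (α := A), sub_mul (α := A)]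
  match_scalars <;> field_simp <;> ring

/-- Here the twisted commutator with b, rather than a, is applied to the relation between `rootV11`
and `rootV31`, which lowers `rootV31` to products of `rootV11` and `rootV21`. -/
theorem rootV11_mul_rootV32 (hrs : r + s ≠ 0) (hrs' : r ^ 2 - r * s + s ^ 2 ≠ 0) :
    rootV11 s a b * rootV32 r s a b = (r ^ 2 * s)⁻¹ • (rootV32 r s a b * rootV11 s a b) := by
  have b11 := h.b_mul_rootV11 hr hs
  have b21 := h.b_mul_rootV21 hr hs
  have b31 := h.b_mul_rootV31 hr hs
  -- The denominator is made opaque so that `field_simp` treats it as an atom.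
  obtain ⟨D, hD⟩ : ∃ D, D = r ^ 2 - r * s + s ^ 2 := ⟨_, rfl⟩
  rw [← hD] at hrs'
  have h₀ := h.rootV11_mul_rootV31 hr hs hrs
  have h₁ := congrArg (b * ·) h₀
  have h₂ := congrArg (· * b) h₀
  simp only [rootV32, b11, mul_mul_of_eq b11, b21, mul_mul_of_eq b21,
    b31, mul_mul_of_eq b31,
    mul_smul_comm, smul_mul_assoc, mul_add (R := A), add_mul (R := A), mul_assoc (G := A), mul_sub (α := A), sub_mul (α := A)] at h₁ h₂ ⊢
  linear_combination (norm := skip)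
    (-(r ^ 2 * s ^ 6) / D) • (h₁ - (r ^ 6 * s ^ 6)⁻¹ • h₂)
  match_scalars <;> field_simp <;> simp only [hD] <;> ring

theorem rootV32_mul_rootV21 (hrs : r + s ≠ 0) (hrs' : r ^ 2 + s ^ 2 ≠ 0)
    (hrs'' : r ^ 2 - r * s + s ^ 2 ≠ 0) :
    rootV32 r s a b * rootV21 r s a b = (r ^ 2 * s)⁻¹ • (rootV21 r s a b * rootV32 r s a b) := by
  have b11 := h.b_mul_rootV11 hr hs
  have b21 := h.b_mul_rootV21 hr hs
  have b31 := h.b_mul_rootV31 hr hs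
  obtain ⟨D, hD⟩ : ∃ D, D = r ^ 2 - r * s + s ^ 2 := ⟨_, rfl⟩
  rw [← hD] at hrs''
  have h₀ := h.rootV21_mul_rootV31 hr hs hrs hrs'
  have h₁ := congrArg (b * ·) h₀
  have h₂ := congrArg (· * b) h₀
  -- Commuting b past `rootV21` leaves a square of `rootV11` next to `rootV31`; these two relations
  -- move `rootV31` across it.
  have h₃ := congrArg (rootV11 s a b * ·) (h.rootV11_mul_rootV31 hr hs hrs)
  have h₄ := congrArg (· * rootV11 s a b) (h.rootV11_mul_rootV31 hr hs hrs)
  simp only [rootV32, b21, mul_mul_of_eq b21,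
    b31, mul_mul_of_eq b31,
    mul_smul_comm, smul_mul_assoc, mul_add (R := A), add_mul (R := A), mul_assoc (G := A), mul_sub (α := A), sub_mul (α := A)] at h₁ h₂ h₃ h₄ ⊢
  linear_combination (norm := skip)
    ((r ^ 2 * s ^ 6) / D) • (h₁ - (r ^ 6 * s ^ 9)⁻¹ • h₂ -
      ((s ^ 2 - r ^ 2) / (r ^ 2 * s ^ 3)) • (h₃ + ((r * s) ^ 3)⁻¹ • h₄))
  match_scalars <;> field_simp <;> simp only [hD] <;> ring

end SerrePair
end RootVectors

/-! ### Spanning sets of iterated Ore-type extensions -/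

section Ore

variable {A : Type*} [Ring A] [Algebra ℂ A]

/-- The elements `b` of `B` with `b x ∈ x B + B`. -/
def oreSubalgebra (B : Subalgebra ℂ A) (x : A) : Subalgebra ℂ A where
  carrier := {b | b ∈ B ∧ ∃ u ∈ B, ∃ v ∈ B, b * x = x * u + v}
  mul_mem' := by
    rintro b c ⟨hb, u, hu, v, hv, h⟩ ⟨hc, u', hu', v', hv', h'⟩
    refine ⟨B.mul_mem hb hc, u * u', B.mul_mem hu hu', v * u' + b * v',
      B.add_mem (B.mul_mem hv hu') (B.mul_mem hb hv'), ?_⟩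
    rw [mul_assoc, h', mul_add, ← mul_assoc, h]
    noncomm_ring
  add_mem' := by
    rintro b c ⟨hb, u, hu, v, hv, h⟩ ⟨hc, u', hu', v', hv', h'⟩
    refine ⟨B.add_mem hb hc, u + u', B.add_mem hu hu', v + v', B.add_mem hv hv', ?_⟩
    rw [add_mul, h, h']
    noncomm_ring
  algebraMap_mem' c := ⟨B.algebraMap_mem c, algebraMap ℂ A c, B.algebraMap_mem c, 0, B.zero_mem,
    by rw [add_zero, Algebra.commutes]⟩

theorem mem_oreSubalgebra_of_eq {B : Subalgebra ℂ A} {x b u v : A} (hb : b ∈ B) (hu : u ∈ B)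
    (hv : v ∈ B) (h : b * x = x * u + v) : b ∈ oreSubalgebra B x :=
  ⟨hb, u, hu, v, hv, h⟩

theorem mem_oreSubalgebra_of_smul {B : Subalgebra ℂ A} {x b : A} {c : ℂ} (hb : b ∈ B)
    (h : b * x = c • (x * b)) : b ∈ oreSubalgebra B x :=
  ⟨hb, c • b, B.smul_mem hb c, 0, B.zero_mem, by rw [h, mul_smul_comm, add_zero]⟩

/-- If `B x ⊆ x B + B` and `v` spans `B`, then the `x ^ n v i` span the algebra generated by
`x` and `B`. -/
theorem adjoin_insert_eq_span {ι : Type*} {G : Set A} {x : A} {v : ι → A}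
    (hv : Subalgebra.toSubmodule (Algebra.adjoin ℂ G) = Submodule.span ℂ (Set.range v))
    (hG : G ⊆ oreSubalgebra (Algebra.adjoin ℂ G) x) :
    Subalgebra.toSubmodule (Algebra.adjoin ℂ (insert x G)) =
      Submodule.span ℂ (Set.range fun p : ℕ × ι => x ^ p.1 * v p.2) := by
  set B := Algebra.adjoin ℂ G with hB
  have hBx : B ≤ oreSubalgebra B x := Algebra.adjoin_le hG
  set S := Submodule.span ℂ (Set.range fun p : ℕ × ι => x ^ p.1 * v p.2) with hS
  have hmem (n : ℕ) (b : A) (hb : b ∈ B) : x ^ n * b ∈ S := by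
    have hb' : b ∈ Submodule.span ℂ (Set.range v) := hv ▸ hb
    induction hb' using Submodule.span_induction with
    | mem b h =>
      obtain ⟨i, rfl⟩ := h
      exact Submodule.subset_span ⟨(n, i), rfl⟩
    | zero => rw [mul_zero]; exact S.zero_mem
    | add b c hb' hc' h h' =>
      rw [mul_add]
      exact S.add_mem (h (by rw [← Subalgebra.mem_toSubmodule, hv]; exact hb'))
        (h' (by rw [← Subalgebra.mem_toSubmodule, hv]; exact hc'))
    | smul t b hb' h =>
      rw [mul_smul_comm]
      exact S.smul_mem t (h (by rw [← Subalgebra.mem_toSubmodule, hv]; exact hb'))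
  have hvB (i : ι) : v i ∈ B := by
    rw [← Subalgebra.mem_toSubmodule, hv]; exact Submodule.subset_span ⟨i, rfl⟩
  have hmulB (y : A) (hy : y ∈ S) (b : A) (hb : b ∈ B) : y * b ∈ S := by
    induction hy using Submodule.span_induction with
    | mem y h =>
      obtain ⟨p, rfl⟩ := h
      dsimp only
      rw [mul_assoc]
      exact hmem _ _ (B.mul_mem (hvB _) hb)
    | zero => rw [zero_mul]; exact S.zero_mem
    | add y z _ _ h h' => rw [add_mul]; exact S.add_mem h h'
    | smul t y _ h => rw [smul_mul_assoc]; exact S.smul_mem t h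
  have hmulx (y : A) (hy : y ∈ S) : y * x ∈ S := by
    induction hy using Submodule.span_induction with
    | mem y h =>
      obtain ⟨p, rfl⟩ := h
      obtain ⟨-, u, hu, w, hw, h⟩ := hBx (hvB p.2)
      dsimp only
      rw [mul_assoc, h, mul_add, ← mul_assoc, ← pow_succ]
      exact S.add_mem (hmem _ _ hu) (hmem _ _ hw)
    | zero => rw [zero_mul]; exact S.zero_mem
    | add y z _ _ h h' => rw [add_mul]; exact S.add_mem h h'
    | smul t y _ h => rw [smul_mul_assoc]; exact S.smul_mem t h
  -- The span is closed under right multiplication by x and by B, hence by all they generate; as it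
  -- contains 1, it is everything.
  have hmul (y z : A) (hz : z ∈ Algebra.adjoin ℂ (insert x G)) : ∀ y ∈ S, y * z ∈ S := by
    induction hz using Algebra.adjoin_induction with
    | mem z h =>
      rcases h with rfl | h
      · exact hmulx
      · exact fun y hy => hmulB y hy z (Algebra.subset_adjoin h)
    | algebraMap t =>
      intro y hy
      rw [← Algebra.commutes, ← Algebra.smul_def]
      exact S.smul_mem t hy
    | add z w _ _ h h' => intro y hy; rw [mul_add]; exact S.add_mem (h y hy) (h' y hy)
    | mul z w _ _ h h' => intro y hy; rw [← mul_assoc]; exact h' _ (h y hy)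
  apply le_antisymm
  · intro z hz
    have := hmul 1 z hz 1 (by simpa using hmem 0 1 B.one_mem)
    rwa [one_mul] at this
  · rw [hS, Submodule.span_le]
    rintro _ ⟨p, rfl⟩
    exact Subalgebra.mul_mem _
      (Subalgebra.pow_mem _ (Algebra.subset_adjoin (Set.mem_insert _ _)) _)
      (Algebra.adjoin_mono (Set.subset_insert _ _) (hvB _))

end Ore

/-! ### Weights and torus monomials -/

section Weight

variable {r s : ℂ} {A : Type*} [Ring A] [Algebra ℂ A] {k l : Aˣ} {x y : A} {m n m' n' : ℕ}

/-- The value at `k₁` of the character of weight `m α₁ + n α₂`. -/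
noncomputable def chi₁ (r s : ℂ) (m n : ℕ) : ℂ := (r ^ (-1 : ℤ) * s ^ (-2 : ℤ)) ^ m * (r ^ 3 * s ^ 3) ^ n

/-- The value at `k₂` of the character of weight `m α₁ + n α₂`. -/
noncomputable def chi₂ (r s : ℂ) (m n : ℕ) : ℂ := (r ^ (-3 : ℤ) * s ^ (-3 : ℤ)) ^ m * (r ^ 6 * s ^ 3) ^ n

/-- `x` has weight `m α₁ + n α₂` with respect to the units `k` and `l`. -/
structure HasWeight (r s : ℂ) (k l : Aˣ) (x : A) (m n : ℕ) : Prop where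
  left : (k : A) * x = chi₁ r s m n • (x * k)
  right : (l : A) * x = chi₂ r s m n • (x * l)

theorem chi₁_add : chi₁ r s (m + m') (n + n') = chi₁ r s m n * chi₁ r s m' n' := by
  simp only [chi₁, pow_add]; ring

theorem chi₂_add : chi₂ r s (m + m') (n + n') = chi₂ r s m n * chi₂ r s m' n' := by
  simp only [chi₂, pow_add]; ring

namespace HasWeight

theorem one : HasWeight r s k l 1 0 0 := by
  constructor <;> simp [chi₁, chi₂]

theorem mul (hx : HasWeight r s k l x m n) (hy : HasWeight r s k l y m' n') :
    HasWeight r s k l (x * y) (m + m') (n + n') := by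
  constructor
  · rw [← mul_assoc, hx.left, smul_mul_assoc, mul_assoc, hy.left, mul_smul_comm, smul_smul,
      chi₁_add, mul_assoc]
  · rw [← mul_assoc, hx.right, smul_mul_assoc, mul_assoc, hy.right, mul_smul_comm, smul_smul,
      chi₂_add, mul_assoc]

theorem sub_smul (hx : HasWeight r s k l x m n) (hy : HasWeight r s k l y m n) (c : ℂ) :
    HasWeight r s k l (x - c • y) m n := by
  constructor
  · rw [mul_sub, mul_smul_comm, hx.left, hy.left, sub_mul, smul_sub, smul_mul_assoc,
      smul_comm c]
  · rw [mul_sub, mul_smul_comm, hx.right, hy.right, sub_mul, smul_sub, smul_mul_assoc,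
      smul_comm c]

theorem pow (hx : HasWeight r s k l x m n) (i : ℕ) :
    HasWeight r s k l (x ^ i) (i * m) (i * n) := by
  induction i with
  | zero => simpa using one
  | succ i ih => simpa only [pow_succ, add_mul, one_mul] using ih.mul hx

end HasWeight

theorem units_zpow_mul {c : ℂ} (hc : c ≠ 0) (h : (k : A) * x = c • (x * k)) (i : ℤ) :
    ((k ^ i : Aˣ) : A) * x = c ^ i • (x * (k ^ i : Aˣ)) := by
  have hinv : ((k⁻¹ : Aˣ) : A) * x = c⁻¹ • (x * (k⁻¹ : Aˣ)) := by
    rw [Units.inv_mul_eq_iff_eq_mul, mul_smul_comm, ← mul_assoc, h, smul_mul_assoc, mul_assoc,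
      Units.mul_inv, mul_one, smul_smul, inv_mul_cancel₀ hc, one_smul]
  induction i with
  | zero => simp
  | succ i ih =>
    rw [zpow_add_one, Units.val_mul, mul_assoc, h, mul_smul_comm, ← mul_assoc, ih, zpow_add_one₀ hc,
      smul_mul_assoc, smul_smul, mul_assoc, mul_comm c]
  | pred i ih =>
    rw [zpow_sub_one, Units.val_mul, mul_assoc, hinv, mul_smul_comm, ← mul_assoc, ih,
      zpow_sub_one₀ hc, smul_mul_assoc, smul_smul, mul_assoc, mul_comm c⁻¹]

/-- The monomial `kⁱ lʲ`. -/
def torusMon (k l : Aˣ) (p : ℤ × ℤ) : Aˣ := k ^ p.1 * l ^ p.2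

theorem torusMon_mul (hk : (k : A) * l = l * k) (p q : ℤ × ℤ) :
    torusMon k l (p + q) = torusMon k l p * torusMon k l q := by
  have : Commute k l := Units.ext hk
  simp only [torusMon, Prod.fst_add, Prod.snd_add, zpow_add]
  rw [mul_assoc, mul_assoc, ← mul_assoc (k ^ q.1), ← mul_assoc (l ^ p.2),
    (this.zpow_zpow q.1 p.2).eq]

theorem chi₁_ne_zero (hr : r ≠ 0) (hs : s ≠ 0) : chi₁ r s m n ≠ 0 := by
  simp [chi₁, hr, hs]

theorem chi₂_ne_zero (hr : r ≠ 0) (hs : s ≠ 0) : chi₂ r s m n ≠ 0 := by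
  simp [chi₂, hr, hs]

theorem HasWeight.torusMon_mul (hr : r ≠ 0) (hs : s ≠ 0) (hx : HasWeight r s k l x m n)
    (p : ℤ × ℤ) :
    (torusMon k l p : A) * x = (chi₁ r s m n ^ p.1 * chi₂ r s m n ^ p.2) • (x * torusMon k l p) := by
  rw [torusMon, Units.val_mul, mul_assoc, units_zpow_mul (chi₂_ne_zero hr hs) hx.right,
    mul_smul_comm, ← mul_assoc, units_zpow_mul (chi₁_ne_zero hr hs) hx.left, smul_mul_assoc,
    smul_smul, mul_assoc, mul_comm (chi₂ r s m n ^ p.2)]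

theorem adjoin_range_torusMon (hk : (k : A) * l = l * k) :
    Subalgebra.toSubmodule (Algebra.adjoin ℂ (Set.range fun p => (torusMon k l p : A))) =
      Submodule.span ℂ (Set.range fun p => (torusMon k l p : A)) := by
  have h : (Submonoid.closure (Set.range fun p => (torusMon k l p : A)) : Set A) =
      Set.range fun p => (torusMon k l p : A) := by
    let f : Multiplicative (ℤ × ℤ) →* A :=
      { toFun := fun p => (torusMon k l p.toAdd : A)
        map_one' := by simp [torusMon]
        map_mul' := fun p q => by rw [toAdd_mul, TwoParamG2.torusMon_mul hk, Units.val_mul] }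
    exact congrArg SetLike.coe (Submonoid.closure_eq (MonoidHom.mrange f))
  rw [Algebra.adjoin_eq_span, h]

end Weight

/-! ### Ordered monomials span -/

section PBW

variable {r s : ℂ} {A : Type*} [Ring A] [Algebra ℂ A] {a b : A} {k l : Aˣ}

namespace TorusAction

variable (h : TorusAction r s a b k l)
include h

theorem hasWeight_a : HasWeight r s k l a 1 0 :=
  ⟨by simpa [chi₁] using h.k_a, by simpa [chi₂] using h.l_a⟩

theorem hasWeight_b : HasWeight r s k l b 0 1 :=
  ⟨by simpa [chi₁] using h.k_b, by simpa [chi₂] using h.l_b⟩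

theorem hasWeight_rootV11 : HasWeight r s k l (rootV11 s a b) 1 1 :=
  (h.hasWeight_a.mul h.hasWeight_b).sub_smul (h.hasWeight_b.mul h.hasWeight_a) _

theorem hasWeight_rootV21 : HasWeight r s k l (rootV21 r s a b) 2 1 :=
  (h.hasWeight_a.mul h.hasWeight_rootV11).sub_smul (h.hasWeight_rootV11.mul h.hasWeight_a) _

theorem hasWeight_rootV31 : HasWeight r s k l (rootV31 r s a b) 3 1 :=
  (h.hasWeight_a.mul h.hasWeight_rootV21).sub_smul (h.hasWeight_rootV21.mul h.hasWeight_a) _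

theorem hasWeight_rootV32 : HasWeight r s k l (rootV32 r s a b) 3 2 :=
  (h.hasWeight_rootV11.mul h.hasWeight_rootV21).sub_smul
    (h.hasWeight_rootV21.mul h.hasWeight_rootV11) _

end TorusAction

/-- The index set of the Poincaré–Birkhoff–Witt basis. -/
abbrev PBWIndex : Type := ℕ × ℕ × ℕ × ℕ × ℕ × ℕ × ℤ × ℤ

/-- The ordered monomials in the root vectors and the torus. -/
noncomputable def pbw (r s : ℂ) (a b : A) (k l : Aˣ) (p : PBWIndex) : A :=
  a ^ p.1 * (rootV31 r s a b ^ p.2.1 * (rootV21 r s a b ^ p.2.2.1 *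
    (rootV32 r s a b ^ p.2.2.2.1 * (rootV11 s a b ^ p.2.2.2.2.1 *
      (b ^ p.2.2.2.2.2.1 * torusMon k l p.2.2.2.2.2.2)))))

/-- The first coefficient of the weight of a monomial. -/
def PBWIndex.deg₁ (p : PBWIndex) : ℕ :=
  p.1 * 1 + (p.2.1 * 3 + (p.2.2.1 * 2 + (p.2.2.2.1 * 3 + (p.2.2.2.2.1 * 1 +
    (p.2.2.2.2.2.1 * 0 + 0)))))

/-- The second coefficient of the weight of a monomial. -/
def PBWIndex.deg₂ (p : PBWIndex) : ℕ :=
  p.1 * 0 + (p.2.1 * 1 + (p.2.2.1 * 1 + (p.2.2.2.1 * 2 + (p.2.2.2.2.1 * 1 +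
    (p.2.2.2.2.2.1 * 1 + 0)))))

theorem hasWeight_torusMon (hk : (k : A) * l = l * k) (p : ℤ × ℤ) :
    HasWeight r s k l (torusMon k l p : A) 0 0 := by
  have : Commute k l := Units.ext hk
  constructor
  · rw [show chi₁ r s 0 0 = 1 by simp [chi₁], one_smul]
    exact congrArg Units.val
      (((Commute.refl k).zpow_right p.1).mul_right (this.zpow_right p.2)).eq
  · rw [show chi₂ r s 0 0 = 1 by simp [chi₂], one_smul]
    exact congrArg Units.val
      ((this.symm.zpow_right p.1).mul_right ((Commute.refl l).zpow_right p.2)).eq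

theorem TorusAction.hasWeight_pbw (h : TorusAction r s a b k l) (p : PBWIndex) :
    HasWeight r s k l (pbw r s a b k l p) p.deg₁ p.deg₂ :=
  (h.hasWeight_a.pow _).mul <| (h.hasWeight_rootV31.pow _).mul <| (h.hasWeight_rootV21.pow _).mul <|
    (h.hasWeight_rootV32.pow _).mul <| (h.hasWeight_rootV11.pow _).mul <|
      (h.hasWeight_b.pow _).mul (hasWeight_torusMon h.comm _)

theorem HasWeight.range_torusMon_subset (hr : r ≠ 0) (hs : s ≠ 0) {x : A} {m n : ℕ}
    (hx : HasWeight r s k l x m n) {G : Set A}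
    (hG : (Set.range fun p => (torusMon k l p : A)) ⊆ G) :
    (Set.range fun p => (torusMon k l p : A)) ⊆ oreSubalgebra (Algebra.adjoin ℂ G) x := by
  rintro _ ⟨p, rfl⟩
  exact mem_oreSubalgebra_of_smul (Algebra.subset_adjoin (hG ⟨p, rfl⟩)) (hx.torusMon_mul hr hs p)

set_option maxHeartbeats 1000000 in
/-- The ordered monomials span the algebra generated by the pair and the torus. -/
theorem adjoin_eq_span_pbw (hr : r ≠ 0) (hs : s ≠ 0) (h₁ : r + s ≠ 0) (h₂ : r ^ 2 + s ^ 2 ≠ 0)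
    (h₃ : r ^ 2 - r * s + s ^ 2 ≠ 0) (hS : SerrePair r s a b) (hT : TorusAction r s a b k l) :
    Subalgebra.toSubmodule (Algebra.adjoin ℂ (insert a <| insert (rootV31 r s a b) <|
      insert (rootV21 r s a b) <| insert (rootV32 r s a b) <| insert (rootV11 s a b) <|
      insert b (Set.range fun p => (torusMon k l p : A)))) =
      Submodule.span ℂ (Set.range (pbw r s a b k l)) := by
  have e₁ : rootV11 s a b * a = (r * s ^ 2)⁻¹ • (a * rootV11 s a b - rootV21 r s a b) := by
    rw [a_mul_rootV11 (r := r), add_sub_cancel_left, smul_smul, inv_mul_cancel₀ (by positivity),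
      one_smul]
  have e₂ : rootV21 r s a b * a = (r ^ 2 * s)⁻¹ • (a * rootV21 r s a b - rootV31 r s a b) := by
    rw [a_mul_rootV21, add_sub_cancel_left, smul_smul, inv_mul_cancel₀ (by positivity),
      one_smul]
  have e₃ : rootV31 r s a b * a = (r ^ 3)⁻¹ • (a * rootV31 r s a b) := by
    rw [hS.a_mul_rootV31, smul_smul, inv_mul_cancel₀ (by positivity), one_smul]
  have e₄ : b * a = (s ^ 3)⁻¹ • (a * b - rootV11 s a b) := by
    rw [a_mul_b (s := s) (a := a), add_sub_cancel_left, smul_smul, inv_mul_cancel₀ (by positivity),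
      one_smul]
  have e₅ : rootV11 s a b * rootV21 r s a b =
      rootV32 r s a b + (r ^ 3)⁻¹ • (rootV21 r s a b * rootV11 s a b) := by
    rw [rootV32]; abel
  have hsub {G : Set A} {x : A} : x ∈ G → x ∈ Algebra.adjoin ℂ G := fun h =>
    Algebra.subset_adjoin h
  have t₁ := adjoin_insert_eq_span (adjoin_range_torusMon hT.comm)
    (hT.hasWeight_b.range_torusMon_subset hr hs subset_rfl)
  have t₂ := adjoin_insert_eq_span (x := rootV11 s a b) t₁ (Set.insert_subset
    (mem_oreSubalgebra_of_smul (hsub (by simp)) (hS.b_mul_rootV11 hr hs))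
    (hT.hasWeight_rootV11.range_torusMon_subset hr hs (Set.subset_insert _ _)))
  have t₃ := adjoin_insert_eq_span (x := rootV32 r s a b) t₂ (Set.insert_subset
    (mem_oreSubalgebra_of_smul (hsub (by simp)) (hS.rootV11_mul_rootV32 hr hs h₁ h₃))
    (Set.insert_subset
    (mem_oreSubalgebra_of_smul (hsub (by simp)) (hS.b_mul_rootV32 hr hs))
    (hT.hasWeight_rootV32.range_torusMon_subset hr hs (by intro x; simp +contextual))))
  have m₄₁ : rootV11 s a b ∈ oreSubalgebra (Algebra.adjoin ℂ <| insert (rootV32 r s a b) <|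
      insert (rootV11 s a b) <| insert b (Set.range fun p => (torusMon k l p : A)))
      (rootV21 r s a b) :=
    mem_oreSubalgebra_of_eq (hsub (by simp))
      (Subalgebra.smul_mem _ (hsub (x := rootV11 s a b) (by simp)) (r ^ 3)⁻¹)
      (hsub (x := rootV32 r s a b) (by simp))
      (by rw [e₅, mul_smul_comm, add_comm])
  have t₄ := adjoin_insert_eq_span (x := rootV21 r s a b) t₃ (Set.insert_subset
    (mem_oreSubalgebra_of_smul (hsub (by simp)) (hS.rootV32_mul_rootV21 hr hs h₁ h₂ h₃))
    (Set.insert_subset m₄₁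
    (Set.insert_subset
    (mem_oreSubalgebra_of_eq (hsub (by simp))
      (Subalgebra.smul_mem _ (hsub (x := b) (by simp)) ((r * s) ^ 3)⁻¹)
      (Subalgebra.smul_mem _ (Subalgebra.mul_mem _ (hsub (x := rootV11 s a b) (by simp))
        (hsub (x := rootV11 s a b) (by simp))) ((s ^ 2 - r ^ 2) / (r ^ 2 * s ^ 3)))
      (by rw [hS.b_mul_rootV21 hr hs, mul_smul_comm]))
    (hT.hasWeight_rootV21.range_torusMon_subset hr hs (by intro x; simp +contextual)))))
  set G₅ := insert (rootV21 r s a b) <| insert (rootV32 r s a b) <| insert (rootV11 s a b) <|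
      insert b (Set.range fun p => (torusMon k l p : A)) with hG₅
  have m₅₂ : rootV21 r s a b ∈ oreSubalgebra (Algebra.adjoin ℂ G₅) (rootV31 r s a b) :=
    mem_oreSubalgebra_of_smul (hsub (by simp [hG₅])) (hS.rootV21_mul_rootV31 hr hs h₁ h₂)
  have m₅₁ : rootV11 s a b ∈ oreSubalgebra (Algebra.adjoin ℂ G₅) (rootV31 r s a b) :=
    mem_oreSubalgebra_of_eq (hsub (by simp [hG₅]))
      (Subalgebra.smul_mem _ (hsub (x := rootV11 s a b) (by simp [hG₅])) ((r * s) ^ 3)⁻¹)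
      (Subalgebra.smul_mem _ (Subalgebra.mul_mem _ m₅₂.1 m₅₂.1)
        ((s ^ 3 - r ^ 3) / (r ^ 2 * s ^ 3 * (r + s))))
      (by rw [hS.rootV11_mul_rootV31 hr hs h₁, mul_smul_comm])
  have t₅ := adjoin_insert_eq_span (x := rootV31 r s a b) t₄ (Set.insert_subset m₅₂
    (Set.insert_subset
    -- No relation between `rootV32` and `rootV31` is needed: `rootV32` is a polynomial in `rootV11`
    -- and `rootV21`, and `oreSubalgebra` is a subalgebra.
    (Subalgebra.sub_mem _ (Subalgebra.mul_mem _ m₅₁ m₅₂)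
      (Subalgebra.smul_mem _ (Subalgebra.mul_mem _ m₅₂ m₅₁) _))
    (Set.insert_subset m₅₁
    (Set.insert_subset
    (mem_oreSubalgebra_of_eq (hsub (by simp [hG₅]))
      (Subalgebra.smul_mem _ (hsub (x := b) (by simp [hG₅])) (r ^ 3 * s ^ 6)⁻¹)
      (Subalgebra.add_mem _
        (Subalgebra.smul_mem _ (Subalgebra.mul_mem _ m₅₂.1 m₅₁.1)
          ((r * s + s ^ 2 - r ^ 2) / (r ^ 2 * s ^ 6)))
        (Subalgebra.smul_mem _ (Subalgebra.mul_mem _ m₅₁.1 m₅₂.1)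
          ((s ^ 2 - r ^ 2 - r * s) / (r * s ^ 4))))
      (by rw [hS.b_mul_rootV31 hr hs, mul_smul_comm, add_assoc]))
    (hT.hasWeight_rootV31.range_torusMon_subset hr hs (by intro x; simp +contextual [hG₅]))))))
  set G₆ := insert (rootV31 r s a b) G₅ with hG₆
  have m₆₃ : rootV31 r s a b ∈ oreSubalgebra (Algebra.adjoin ℂ G₆) a :=
    mem_oreSubalgebra_of_smul (hsub (by simp [hG₆])) e₃
  have hneg {x : A} (hx : x ∈ Algebra.adjoin ℂ G₆) (c : ℂ) : -(c • x) ∈ Algebra.adjoin ℂ G₆ :=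
    Subalgebra.neg_mem _ (Subalgebra.smul_mem _ hx c)
  have m₆₂ : rootV21 r s a b ∈ oreSubalgebra (Algebra.adjoin ℂ G₆) a :=
    mem_oreSubalgebra_of_eq (hsub (by simp [hG₆, hG₅]))
      (Subalgebra.smul_mem _ (hsub (x := rootV21 r s a b) (by simp [hG₆, hG₅])) (r ^ 2 * s)⁻¹)
      (hneg m₆₃.1 (r ^ 2 * s)⁻¹) (by rw [e₂, smul_sub, mul_smul_comm, sub_eq_add_neg])
  have m₆₁ : rootV11 s a b ∈ oreSubalgebra (Algebra.adjoin ℂ G₆) a :=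
    mem_oreSubalgebra_of_eq (hsub (by simp [hG₆, hG₅]))
      (Subalgebra.smul_mem _ (hsub (x := rootV11 s a b) (by simp [hG₆, hG₅])) (r * s ^ 2)⁻¹)
      (hneg m₆₂.1 (r * s ^ 2)⁻¹) (by rw [e₁, smul_sub, mul_smul_comm, sub_eq_add_neg])
  exact adjoin_insert_eq_span t₅ (Set.insert_subset m₆₃ (Set.insert_subset m₆₂
    (Set.insert_subset
    (Subalgebra.sub_mem _ (Subalgebra.mul_mem _ m₆₁ m₆₂)
      (Subalgebra.smul_mem _ (Subalgebra.mul_mem _ m₆₂ m₆₁) _))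
    (Set.insert_subset m₆₁
    (Set.insert_subset
    (mem_oreSubalgebra_of_eq (hsub (by simp [hG₆, hG₅]))
      (Subalgebra.smul_mem _ (hsub (x := b) (by simp [hG₆, hG₅])) (s ^ 3)⁻¹)
      (hneg m₆₁.1 (s ^ 3)⁻¹) (by rw [e₄, smul_sub, mul_smul_comm, sub_eq_add_neg]))
    (hT.hasWeight_a.range_torusMon_subset hr hs (by intro x; simp +contextual [hG₆, hG₅])))))))

end PBW

/-- The ordered monomials span `AugBorel`. -/
theorem span_pbw {r s : ℂ} (hr : r ≠ 0) (hs : s ≠ 0) (h₁ : r + s ≠ 0) (h₂ : r ^ 2 + s ^ 2 ≠ 0)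
    (h₃ : r ^ 2 - r * s + s ^ 2 ≠ 0) :
    Submodule.span ℂ (Set.range (pbw r s (e₁ r s) (e₂ r s) (k₁ r s) (k₂ r s))) = ⊤ := by
  rw [← adjoin_eq_span_pbw hr hs h₁ h₂ h₃ (serrePair r s) (torusAction r s),
    ← Algebra.top_toSubmodule]
  refine congrArg _ (subalgebra_eq_top ?_ ?_ ?_ ?_ ?_ ?_)
  · exact Algebra.subset_adjoin (by simp)
  · exact Algebra.subset_adjoin (by simp)
  all_goals
    refine Algebra.subset_adjoin ?_
    iterate 6 refine Set.mem_insert_of_mem _ ?_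
  · exact ⟨(1, 0), by simp [torusMon]⟩
  · exact ⟨(-1, 0), by simp [torusMon]⟩
  · exact ⟨(0, 1), by simp [torusMon]⟩
  · exact ⟨(0, -1), by simp [torusMon]⟩


/-! ### Enlarging a Serre pair by a skew-commuting element -/

section Extend

variable {r s : ℂ} {A : Type*} [Ring A] [Algebra ℂ A] {a b x : A}

theorem SerrePair.zero (r s : ℂ) : SerrePair r s (0 : A) 0 := by
  constructor <;> simp

/-- Once x is moved to the right, the terms free of a vanish because r³ and r⁻³ are roots of the two
Serre polynomials. Those involving both a and x cancel by (r, s)-binomial identities, and the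
relations for a and b remain. In `add_right` the roots s³ and s⁻³ play this role. -/
theorem SerrePair.add_left (hr : r ≠ 0) (hs : s ≠ 0) (h : SerrePair r s a b)
    (ha : x * a = (s / r) • (a * x)) (hb : x * b = r ^ 3 • (b * x)) :
    SerrePair r s (a + x) b := by
  have h₁ := h.serre_b
  have h₂ := h.serre_a
  constructor
  · simp only [pow_succ, pow_zero, one_mul, hb, mul_mul_of_eq hb, mul_smul_comm, smul_mul_assoc,
      mul_add (R := A), add_mul (R := A), mul_assoc (G := A)] at h₁ ⊢
    linear_combination (norm := skip) (1 : ℂ) • h₁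
    match_scalars <;> field_simp <;> ring
  · simp only [pow_succ, pow_zero, one_mul, ha, mul_mul_of_eq ha, hb, mul_mul_of_eq hb,
      mul_smul_comm, smul_mul_assoc,
      mul_add (R := A), add_mul (R := A), mul_assoc (G := A)] at h₂ ⊢
    linear_combination (norm := skip) (1 : ℂ) • h₂
    match_scalars <;> field_simp <;> ring

theorem SerrePair.add_right (hr : r ≠ 0) (hs : s ≠ 0) (h : SerrePair r s a b)
    (ha : x * a = (s ^ 3)⁻¹ • (a * x)) (hb : x * b = (s / r) ^ 3 • (b * x)) :
    SerrePair r s a (b + x) := by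
  have h₁ := h.serre_b
  have h₂ := h.serre_a
  constructor
  · simp only [pow_succ, pow_zero, one_mul, ha, mul_mul_of_eq ha, hb,
      mul_smul_comm, smul_mul_assoc,
      mul_add (R := A), add_mul (R := A), mul_assoc (G := A)] at h₁ ⊢
    linear_combination (norm := skip) (1 : ℂ) • h₁
    match_scalars <;> field_simp <;> ring
  · simp only [pow_succ, pow_zero, one_mul, ha, mul_mul_of_eq ha,
      mul_smul_comm, smul_mul_assoc,
      mul_add (R := A), add_mul (R := A), mul_assoc (G := A)] at h₂ ⊢
    linear_combination (norm := skip) (1 : ℂ) • h₂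
    match_scalars <;> field_simp <;> ring

end Extend

/-! ### Root vectors in the quantum affine space -/

section QTorus

variable {r s : ℂ} {A : Type*} [Ring A] [Algebra ℂ A]

/-- The commutation rules of the letters of the quantum affine space attached to the reduced word
`(1, 2, 1, 2, 1, 2)`. -/
structure QAffine (r s : ℂ) (x₁ x₂ x₃ x₄ x₅ x₆ : A) : Prop where
  h₂₁ : x₂ * x₁ = (s ^ 3)⁻¹ • (x₁ * x₂)
  h₃₁ : x₃ * x₁ = (s / r) • (x₁ * x₃)
  h₄₁ : x₄ * x₁ = (s ^ 3)⁻¹ • (x₁ * x₄)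
  h₅₁ : x₅ * x₁ = (s / r) • (x₁ * x₅)
  h₆₁ : x₆ * x₁ = (s ^ 3)⁻¹ • (x₁ * x₆)
  h₃₂ : x₃ * x₂ = r ^ 3 • (x₂ * x₃)
  h₄₂ : x₄ * x₂ = (s / r) ^ 3 • (x₂ * x₄)
  h₅₂ : x₅ * x₂ = r ^ 3 • (x₂ * x₅)
  h₆₂ : x₆ * x₂ = (s / r) ^ 3 • (x₂ * x₆)
  h₄₃ : x₄ * x₃ = (s ^ 3)⁻¹ • (x₃ * x₄)
  h₅₃ : x₅ * x₃ = (s / r) • (x₃ * x₅)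
  h₆₃ : x₆ * x₃ = (s ^ 3)⁻¹ • (x₃ * x₆)
  h₅₄ : x₅ * x₄ = r ^ 3 • (x₄ * x₅)
  h₆₄ : x₆ * x₄ = (s / r) ^ 3 • (x₄ * x₆)
  h₆₅ : x₆ * x₅ = (s ^ 3)⁻¹ • (x₅ * x₆)

namespace QAffine

variable {x₁ x₂ x₃ x₄ x₅ x₆ : A} (hr : r ≠ 0) (hs : s ≠ 0) (h : QAffine r s x₁ x₂ x₃ x₄ x₅ x₆)
include hr hs h

/-- The letters are adjoined one at a time in the order of the word: each skew-commutes with all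
earlier odd letters by one factor, and with all earlier even letters by another. -/
theorem serrePair : SerrePair r s (x₁ + x₃ + x₅) (x₂ + x₄ + x₆) := by
  have := (SerrePair.zero (A := A) r s).add_left hr hs (x := x₁) (by simp) (by simp)
  have := this.add_right hr hs (x := x₂) (by simp [h.h₂₁]) (by simp)
  have := this.add_left hr hs (x := x₃) (by simp [h.h₃₁]) (by simp [h.h₃₂])
  have := this.add_right hr hs (x := x₄) (by simp [h.h₄₁, h.h₄₃, mul_add, add_mul])
    (by simp [h.h₄₂])
  have := this.add_left hr hs (x := x₅) (by simp [h.h₅₁, h.h₅₃, mul_add, add_mul])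
    (by simp [h.h₅₂, h.h₅₄, mul_add, add_mul])
  have := this.add_right hr hs (x := x₆) (by simp [h.h₆₁, h.h₆₃, h.h₆₅, mul_add, add_mul])
    (by simp [h.h₆₂, h.h₆₄, mul_add, add_mul])
  simpa using this

theorem rootV11_eq : rootV11 s (x₁ + x₃ + x₅) (x₂ + x₄ + x₆) =
    (r ^ 3 - s ^ 3) • (x₄ * x₅ + x₂ * x₅ + x₂ * x₃) := by
  simp only [rootV11, h.h₂₁, h.h₄₁, h.h₆₁, h.h₃₂, h.h₅₂, h.h₄₃, h.h₆₃, h.h₅₄, h.h₆₅,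
    mul_add (R := A), add_mul (R := A)]
  match_scalars <;> field_simp <;> ring

theorem rootV21_eq : rootV21 r s (x₁ + x₃ + x₅) (x₂ + x₄ + x₆) =
    ((r ^ 3 - s ^ 3) * (r ^ 2 - s ^ 2)) • (r • (x₄ * (x₅ * x₅)) + r • (x₂ * (x₅ * x₅)) +
      (r + s) • (x₂ * (x₃ * x₅)) + r • (x₂ * (x₃ * x₃))) := by
  simp only [rootV21, h.rootV11_eq hr hs, h.h₃₁, h.h₅₁, h.h₅₃,
    mul_mul_of_eq h.h₂₁, mul_mul_of_eq h.h₄₁,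
    mul_mul_of_eq h.h₃₂, mul_mul_of_eq h.h₅₂, mul_mul_of_eq h.h₄₃,
    mul_mul_of_eq h.h₅₄, mul_smul_comm, smul_mul_assoc,
    mul_add (R := A), add_mul (R := A), mul_assoc (G := A)]
  match_scalars <;> field_simp <;> ring

theorem rootV31_eq : rootV31 r s (x₁ + x₃ + x₅) (x₂ + x₄ + x₆) =
    ((r ^ 3 - s ^ 3) * (r ^ 2 - s ^ 2) * (r - s) * r) • (r ^ 2 • (x₂ * (x₃ * (x₃ * x₃))) +
      r ^ 2 • (x₄ * (x₅ * (x₅ * x₅))) + r ^ 2 • (x₂ * (x₅ * (x₅ * x₅))) +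
      (r ^ 2 + r * s + s ^ 2) • (x₂ * (x₃ * (x₃ * x₅))) +
      (r ^ 2 + r * s + s ^ 2) • (x₂ * (x₃ * (x₅ * x₅)))) := by
  simp only [rootV31, h.rootV21_eq hr hs, h.h₃₁, h.h₅₁, h.h₅₃,
    mul_mul_of_eq h.h₂₁, mul_mul_of_eq h.h₄₁, mul_mul_of_eq h.h₃₁, mul_mul_of_eq h.h₅₁,
    mul_mul_of_eq h.h₃₂, mul_mul_of_eq h.h₅₂, mul_mul_of_eq h.h₄₃, mul_mul_of_eq h.h₅₃,
    mul_mul_of_eq h.h₅₄, mul_smul_comm, smul_mul_assoc,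
    mul_add (R := A), add_mul (R := A), mul_assoc (G := A)]
  match_scalars <;> field_simp <;> ring

theorem rootV32_eq : rootV32 r s (x₁ + x₃ + x₅) (x₂ + x₄ + x₆) =
    ((r ^ 3 - s ^ 3) ^ 2 * (r ^ 2 - s ^ 2) * (r - s) / (r ^ 2 * s)) •
      (x₂ * (x₃ * (x₃ * (x₄ * x₅)))) := by
  simp only [rootV32, h.rootV21_eq hr hs, h.rootV11_eq hr hs, h.h₅₃,
    mul_mul_of_eq h.h₃₂, mul_mul_of_eq h.h₅₂, mul_mul_of_eq h.h₄₃, mul_mul_of_eq h.h₅₃,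
    mul_mul_of_eq h.h₄₂, mul_mul_of_eq h.h₅₄, mul_smul_comm, smul_mul_assoc,
    mul_add (R := A), add_mul (R := A), mul_assoc (G := A)]
  match_scalars <;> field_simp <;> ring

end QAffine
end QTorus

/-! ### Operators with leading exponents on the group algebra of an ordered group -/

section Lead

variable {Γ : Type*} [AddCommGroup Γ] [LinearOrder Γ] [IsOrderedAddMonoid Γ]

/-- The operator `T` moves every basis vector `δ_b` to a nonzero multiple of `δ_{g + b}` up to
smaller terms. -/
def HasLead (T : Module.End ℂ (Γ →₀ ℂ)) (g : Γ) : Prop :=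
  ∀ b, T (Finsupp.single b 1) (g + b) ≠ 0 ∧ ∀ d, g + b < d → T (Finsupp.single b 1) d = 0

namespace HasLead

variable {S T : Module.End ℂ (Γ →₀ ℂ)} {g h : Γ}

theorem apply_eq_sum (T : Module.End ℂ (Γ →₀ ℂ)) (f : Γ →₀ ℂ) (e : Γ) :
    T f e = f.sum fun c x => x * T (Finsupp.single c 1) e := by
  conv_lhs => rw [← Finsupp.sum_single f]
  rw [Finsupp.sum, map_sum, Finsupp.finsetSum_apply, Finsupp.sum]
  refine Finset.sum_congr rfl fun c _ => ?_
  rw [← mul_one (f c), ← smul_eq_mul, ← Finsupp.smul_single, map_smul, Finsupp.smul_apply]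
  simp

theorem ne_zero (hT : HasLead T g) : T ≠ 0 := by
  rintro rfl
  exact (hT 0).1 (by simp)

/-- In degrees at least g + h + b only the top term of S δ_b can contribute, so leading coefficients
multiply and cannot vanish. -/
theorem mul (hT : HasLead T g) (hS : HasLead S h) : HasLead (T * S) (g + h) := by
  intro b
  set f := S (Finsupp.single b 1) with hf
  have hz (e : Γ) (he : g + h + b ≤ e) (c : Γ) (hc : c ≠ h + b) :
      f c * T (Finsupp.single c 1) e = 0 := by
    rcases lt_or_gt_of_ne hc with h' | h'
    · rw [(hT c).2 e (lt_of_lt_of_le ?_ he), mul_zero]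
      rw [add_assoc]
      gcongr
    · rw [hf, (hS b).2 c h', zero_mul]
  have key (e : Γ) (he : g + h + b ≤ e) :
      (T * S) (Finsupp.single b 1) e = f (h + b) * T (Finsupp.single (h + b) 1) e := by
    rw [Module.End.mul_apply, apply_eq_sum, Finsupp.sum]
    refine Finset.sum_eq_single _ (fun c _ hc => hz e he c hc) fun hc => ?_
    rw [← hf, Finsupp.notMem_support_iff.1 hc, zero_mul]
  constructor
  · rw [key _ le_rfl, add_assoc]
    exact mul_ne_zero (hS b).1 (hT _).1
  · intro d hd
    rw [key _ hd.le, (hT _).2 d (by rwa [← add_assoc]), mul_zero]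

theorem one : HasLead (1 : Module.End ℂ (Γ →₀ ℂ)) 0 := by
  intro b
  constructor
  · simp
  · intro d hd
    rw [zero_add] at hd
    simp [hd.ne]

theorem pow (hT : HasLead T g) (n : ℕ) : HasLead (T ^ n) (n • g) := by
  induction n with
  | zero => simpa using one
  | succ n ih => simpa only [pow_succ, succ_nsmul] using ih.mul hT

theorem smul (hT : HasLead T g) {c : ℂ} (hc : c ≠ 0) : HasLead (c • T) g := by
  intro b
  constructor
  · simpa [hc] using (hT b).1
  · intro d hd
    simp [(hT b).2 d hd]

theorem add_of_lt (hT : HasLead T g) (hS : HasLead S h) (hlt : h < g) : HasLead (T + S) g := by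
  intro b
  have hlt' : h + b < g + b := by gcongr
  constructor
  · simpa [(hS b).2 _ hlt'] using (hT b).1
  · intro d hd
    simp [(hT b).2 _ hd, (hS b).2 _ (hlt'.trans hd)]

/-- A nonzero combination of operators with distinct leading exponents has a leading exponent. -/
theorem exists_sum {ι : Type*} {v : ι → Module.End ℂ (Γ →₀ ℂ)} {g : ι → Γ}
    (hv : ∀ i, HasLead (v i) (g i)) (hg : Function.Injective g) (c : ι →₀ ℂ) (hc : c ≠ 0) :
    ∃ i ∈ c.support, HasLead (c.sum fun i t => t • v i) (g i) := by
  obtain ⟨i, hi, hmax⟩ := c.support.exists_max_image g (Finsupp.support_nonempty_iff.2 hc)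
  refine ⟨i, hi, fun b => ?_⟩
  have key (e : Γ) (he : g i + b ≤ e) : (c.sum fun i t => t • v i) (Finsupp.single b 1) e =
      c i * v i (Finsupp.single b 1) e := by
    rw [Finsupp.sum, LinearMap.sum_apply, Finsupp.finsetSum_apply,
      Finset.sum_eq_single_of_mem i hi]
    · simp
    · intro j hj hji
      have hlt : g j < g i := lt_of_le_of_ne (hmax j hj) (hg.ne hji)
      simp [(hv j b).2 e (lt_of_lt_of_le (by gcongr) he)]
  constructor
  · rw [key _ le_rfl]
    exact mul_ne_zero (Finsupp.mem_support_iff.1 hi) (hv i b).1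
  · intro d hd
    rw [key _ hd.le, (hv i b).2 d hd, mul_zero]

end HasLead

/-- The operator `δ_b ↦ q(g, b) δ_{g + b}`. -/
noncomputable def qMon (q : Γ → Γ → ℂ) (g : Γ) : Module.End ℂ (Γ →₀ ℂ) :=
  Finsupp.lsum ℂ fun b => q g b • Finsupp.lsingle (g + b)

theorem qMon_single (q : Γ → Γ → ℂ) (g b : Γ) (t : ℂ) :
    qMon q g (Finsupp.single b t) = Finsupp.single (g + b) (q g b * t) := by
  simp [qMon]

theorem hasLead_qMon {q : Γ → Γ → ℂ} (hq : ∀ g h, q g h ≠ 0) (g : Γ) : HasLead (qMon q g) g := by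
  intro b
  rw [qMon_single]
  constructor
  · simpa using hq g b
  · intro d hd
    simp [hd.ne]

/-- Bimultiplicativity of q makes composition the twisted group algebra product. Realising the
quantum torus by operators gives associativity for free. -/
theorem qMon_mul {q : Γ → Γ → ℂ} (hl : ∀ a b c, q (a + b) c = q a c * q b c)
    (hr : ∀ a b c, q a (b + c) = q a b * q a c) (g h : Γ) :
    qMon q g * qMon q h = q g h • qMon q (g + h) := by
  refine Finsupp.lhom_ext fun b t => ?_
  simp only [Module.End.mul_apply, qMon_single, LinearMap.smul_apply, Finsupp.smul_single,
    smul_eq_mul, hl, hr, add_assoc]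
  congr 1
  ring

theorem qMon_zero {q : Γ → Γ → ℂ} (hq : ∀ g h, q g h ≠ 0)
    (hl : ∀ a b c, q (a + b) c = q a c * q b c) : qMon q 0 = 1 := by
  have h0 (c : Γ) : q 0 c = 1 := by
    have := hl 0 0 c
    rw [add_zero] at this
    exact (mul_eq_left₀ (hq 0 c)).1 this.symm
  refine Finsupp.lhom_ext fun b t => ?_
  simp [qMon_single, h0]

end Lead

/-! ### The quantum torus and the Feigin-type homomorphism -/

section Feigin

/-- The exponents of the quantum torus: coordinate `0` records a weight used to order monomials,
coordinates `1, …, 6` the exponents of the six letters, coordinates `7, 8` those of `k₁, k₂`. -/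
abbrev QLattice : Type := Lex (Fin 9 → ℤ)

/-- The exponent of `r` in the commutation cocycle. -/
def formR (a b : Fin 9 → ℤ) : ℤ :=
  -(a 3 * b 1 + a 5 * b 1 + a 5 * b 3) + 3 * (a 3 * b 2 + a 5 * b 2 + a 5 * b 4)
    - 3 * (a 4 * b 2 + a 6 * b 2 + a 6 * b 4)
    + a 7 * (-(b 1 + b 3 + b 5) + 3 * (b 2 + b 4 + b 6))
    + a 8 * (-3 * (b 1 + b 3 + b 5) + 6 * (b 2 + b 4 + b 6))

/-- The exponent of `s` in the commutation cocycle. -/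
def formS (a b : Fin 9 → ℤ) : ℤ :=
  (a 3 * b 1 + a 5 * b 1 + a 5 * b 3)
    - 3 * (a 2 * b 1 + a 4 * b 1 + a 4 * b 3 + a 6 * b 1 + a 6 * b 3 + a 6 * b 5)
    + 3 * (a 4 * b 2 + a 6 * b 2 + a 6 * b 4)
    + a 7 * (-2 * (b 1 + b 3 + b 5) + 3 * (b 2 + b 4 + b 6))
    + a 8 * (-3 * (b 1 + b 3 + b 5) + 3 * (b 2 + b 4 + b 6))

/-- The commutation cocycle. -/
noncomputable def cocycle (r s : ℂ) (a b : QLattice) : ℂ :=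
  r ^ formR (ofLex a) (ofLex b) * s ^ formS (ofLex a) (ofLex b)

variable {r s : ℂ}

theorem cocycle_ne_zero (hr : r ≠ 0) (hs : s ≠ 0) (a b : QLattice) : cocycle r s a b ≠ 0 :=
  mul_ne_zero (zpow_ne_zero _ hr) (zpow_ne_zero _ hs)

theorem cocycle_add_left (hr : r ≠ 0) (hs : s ≠ 0) (a b c : QLattice) :
    cocycle r s (a + b) c = cocycle r s a c * cocycle r s b c := by
  have h₁ : formR (ofLex (a + b)) (ofLex c) =
      formR (ofLex a) (ofLex c) + formR (ofLex b) (ofLex c) := by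
    simp only [formR, ofLex_add, Pi.add_apply]; ring
  have h₂ : formS (ofLex (a + b)) (ofLex c) =
      formS (ofLex a) (ofLex c) + formS (ofLex b) (ofLex c) := by
    simp only [formS, ofLex_add, Pi.add_apply]; ring
  rw [cocycle, h₁, h₂, zpow_add₀ hr, zpow_add₀ hs, cocycle, cocycle]
  ring

theorem cocycle_add_right (hr : r ≠ 0) (hs : s ≠ 0) (a b c : QLattice) :
    cocycle r s a (b + c) = cocycle r s a b * cocycle r s a c := by
  have h₁ : formR (ofLex a) (ofLex (b + c)) =
      formR (ofLex a) (ofLex b) + formR (ofLex a) (ofLex c) := by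
    simp only [formR, ofLex_add, Pi.add_apply]; ring
  have h₂ : formS (ofLex a) (ofLex (b + c)) =
      formS (ofLex a) (ofLex b) + formS (ofLex a) (ofLex c) := by
    simp only [formS, ofLex_add, Pi.add_apply]; ring
  rw [cocycle, h₁, h₂, zpow_add₀ hr, zpow_add₀ hs, cocycle, cocycle]
  ring

/-- A monomial of the quantum torus. -/
noncomputable def qm (r s : ℂ) (v : Fin 9 → ℤ) : Module.End ℂ (QLattice →₀ ℂ) :=
  qMon (cocycle r s) (toLex v)

theorem hasLead_qm (hr : r ≠ 0) (hs : s ≠ 0) (v : Fin 9 → ℤ) : HasLead (qm r s v) (toLex v) :=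
  hasLead_qMon (cocycle_ne_zero hr hs) _

theorem qm_comm (hr : r ≠ 0) (hs : s ≠ 0) {v w : Fin 9 → ℤ} {c : ℂ}
    (h : r ^ formR v w * s ^ formS v w = c * (r ^ formR w v * s ^ formS w v)) :
    qm r s v * qm r s w = c • (qm r s w * qm r s v) := by
  rw [qm, qm, qMon_mul (cocycle_add_left hr hs) (cocycle_add_right hr hs),
    qMon_mul (cocycle_add_left hr hs) (cocycle_add_right hr hs), smul_smul, add_comm]
  exact congrArg (· • _) h

theorem qm_mul_eq_one (hr : r ≠ 0) (hs : s ≠ 0) {v w : Fin 9 → ℤ} (hvw : v + w = 0)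
    (hR : formR v w = 0) (hS : formS v w = 0) : qm r s v * qm r s w = 1 := by
  rw [qm, qm, qMon_mul (cocycle_add_left hr hs) (cocycle_add_right hr hs), ← toLex_add, hvw,
    toLex_zero, qMon_zero (cocycle_ne_zero hr hs) (cocycle_add_left hr hs), cocycle]
  simp [hR, hS]

/-- An invertible monomial of the quantum torus. -/
noncomputable def qmUnit (hr : r ≠ 0) (hs : s ≠ 0) (v : Fin 9 → ℤ)
    (hR : formR v v = 0) (hS : formS v v = 0) : (Module.End ℂ (QLattice →₀ ℂ))ˣ where
  val := qm r s v
  inv := qm r s (-v)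
  val_inv := qm_mul_eq_one hr hs (add_neg_cancel v)
    (by simp only [formR, Pi.neg_apply] at hR ⊢; linarith)
    (by simp only [formS, Pi.neg_apply] at hS ⊢; linarith)
  inv_val := qm_mul_eq_one hr hs (neg_add_cancel v)
    (by simp only [formR, Pi.neg_apply] at hR ⊢; linarith)
    (by simp only [formS, Pi.neg_apply] at hS ⊢; linarith)

theorem hasLead_qmUnit_zpow (hr : r ≠ 0) (hs : s ≠ 0) (v : Fin 9 → ℤ)
    (hR : formR v v = 0) (hS : formS v v = 0) (i : ℤ) :
    HasLead (((qmUnit hr hs v hR hS) ^ i : (Module.End ℂ (QLattice →₀ ℂ))ˣ) :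
      Module.End ℂ (QLattice →₀ ℂ)) (i • toLex v) := by
  obtain ⟨n, rfl | rfl⟩ := i.eq_nat_or_neg
  · rw [zpow_natCast, Units.val_pow_eq_pow_val, natCast_zsmul]
    exact (hasLead_qm hr hs v).pow n
  · rw [zpow_neg, zpow_natCast, ← inv_pow, Units.val_pow_eq_pow_val, neg_zsmul, natCast_zsmul,
      ← neg_nsmul]
    exact (hasLead_qm hr hs (-v)).pow n

/-- The exponents of the letters of the quantum torus. -/
def letterExp : Fin 8 → Fin 9 → ℤ :=
  -- The weights 3, 0, 2, 5, 0, 6 in coordinate 0 give the root vectors linearly independent leading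
  -- exponents: x₁, x₂x₃³, x₄x₅², x₂x₃²x₄x₅, x₄x₅, x₆ in the PBW order. The cocycle ignores this
  -- coordinate.
  ![![3, 1, 0, 0, 0, 0, 0, 0, 0], ![0, 0, 1, 0, 0, 0, 0, 0, 0], ![2, 0, 0, 1, 0, 0, 0, 0, 0],
    ![5, 0, 0, 0, 1, 0, 0, 0, 0], ![0, 0, 0, 0, 0, 1, 0, 0, 0], ![6, 0, 0, 0, 0, 0, 1, 0, 0],
    ![0, 0, 0, 0, 0, 0, 0, 1, 0], ![0, 0, 0, 0, 0, 0, 0, 0, 1]]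

theorem qAffine_letters (hr : r ≠ 0) (hs : s ≠ 0) :
    QAffine r s (qm r s (letterExp 0)) (qm r s (letterExp 1)) (qm r s (letterExp 2))
      (qm r s (letterExp 3)) (qm r s (letterExp 4)) (qm r s (letterExp 5)) := by
  constructor <;> refine qm_comm hr hs ?_ <;> simp [formR, formS, letterExp] <;> field_simp

/-- The image of `k₁` in the quantum torus. -/
noncomputable def torusK (hr : r ≠ 0) (hs : s ≠ 0) : (Module.End ℂ (QLattice →₀ ℂ))ˣ :=
  qmUnit hr hs (letterExp 6) (by simp [formR, letterExp]) (by simp [formS, letterExp])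

/-- The image of `k₂` in the quantum torus. -/
noncomputable def torusL (hr : r ≠ 0) (hs : s ≠ 0) : (Module.End ℂ (QLattice →₀ ℂ))ˣ :=
  qmUnit hr hs (letterExp 7) (by simp [formR, letterExp]) (by simp [formS, letterExp])

theorem torusAction_letters (hr : r ≠ 0) (hs : s ≠ 0) :
    TorusAction r s (qm r s (letterExp 0) + qm r s (letterExp 2) + qm r s (letterExp 4))
      (qm r s (letterExp 1) + qm r s (letterExp 3) + qm r s (letterExp 5))
      (torusK hr hs) (torusL hr hs) := by
  have hk : ((torusK hr hs : (Module.End ℂ (QLattice →₀ ℂ))ˣ) :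
      Module.End ℂ (QLattice →₀ ℂ)) = qm r s (letterExp 6) := rfl
  have hl : ((torusL hr hs : (Module.End ℂ (QLattice →₀ ℂ))ˣ) :
      Module.End ℂ (QLattice →₀ ℂ)) = qm r s (letterExp 7) := rfl
  constructor
  · rw [hk, hl, ← one_smul ℂ (qm r s (letterExp 7) * qm r s (letterExp 6))]
    refine qm_comm hr hs ?_
    simp [formR, formS, letterExp]
  · rw [hk, mul_add, mul_add, add_mul, add_mul, smul_add, smul_add,
      qm_comm hr hs (v := letterExp 6) (w := letterExp 0) (c := r ^ (-1 : ℤ) * s ^ (-2 : ℤ))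
        (by simp [formR, formS, letterExp]),
      qm_comm hr hs (v := letterExp 6) (w := letterExp 2) (c := r ^ (-1 : ℤ) * s ^ (-2 : ℤ))
        (by simp [formR, formS, letterExp]),
      qm_comm hr hs (v := letterExp 6) (w := letterExp 4) (c := r ^ (-1 : ℤ) * s ^ (-2 : ℤ))
        (by simp [formR, formS, letterExp])]
  · rw [hk, mul_add, mul_add, add_mul, add_mul, smul_add, smul_add,
      qm_comm hr hs (v := letterExp 6) (w := letterExp 1) (c := r ^ 3 * s ^ 3)
        (by simp [formR, formS, letterExp]),
      qm_comm hr hs (v := letterExp 6) (w := letterExp 3) (c := r ^ 3 * s ^ 3)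
        (by simp [formR, formS, letterExp]),
      qm_comm hr hs (v := letterExp 6) (w := letterExp 5) (c := r ^ 3 * s ^ 3)
        (by simp [formR, formS, letterExp])]
  · rw [hl, mul_add, mul_add, add_mul, add_mul, smul_add, smul_add,
      qm_comm hr hs (v := letterExp 7) (w := letterExp 0) (c := r ^ (-3 : ℤ) * s ^ (-3 : ℤ))
        (by simp [formR, formS, letterExp]),
      qm_comm hr hs (v := letterExp 7) (w := letterExp 2) (c := r ^ (-3 : ℤ) * s ^ (-3 : ℤ))
        (by simp [formR, formS, letterExp]),
      qm_comm hr hs (v := letterExp 7) (w := letterExp 4) (c := r ^ (-3 : ℤ) * s ^ (-3 : ℤ))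
        (by simp [formR, formS, letterExp])]
  · rw [hl, mul_add, mul_add, add_mul, add_mul, smul_add, smul_add,
      qm_comm hr hs (v := letterExp 7) (w := letterExp 1) (c := r ^ 6 * s ^ 3)
        (by simp [formR, formS, letterExp]),
      qm_comm hr hs (v := letterExp 7) (w := letterExp 3) (c := r ^ 6 * s ^ 3)
        (by simp [formR, formS, letterExp]),
      qm_comm hr hs (v := letterExp 7) (w := letterExp 5) (c := r ^ 6 * s ^ 3)
        (by simp [formR, formS, letterExp])]

/-- The Feigin-type representation of `AugBorel` by operators on the group algebra of a lattice. -/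
noncomputable def feigin (hr : r ≠ 0) (hs : s ≠ 0) :
    AugBorel r s →ₐ[ℂ] Module.End ℂ (QLattice →₀ ℂ) :=
  lift ((qAffine_letters hr hs).serrePair hr hs) (torusAction_letters hr hs)

end Feigin

/-! ### Consequences of genericity, and leading exponents of the root vectors -/

variable {r s : ℂ}

/-- The parameters are multiplicatively independent. -/
def Generic (r s : ℂ) : Prop := ∀ m n : ℤ, r ^ m * s ^ n = 1 → m = 0 ∧ n = 0

theorem Generic.pow_ne (h : Generic r s) (hs : s ≠ 0) {n : ℕ} (hn : n ≠ 0) : r ^ n ≠ s ^ n := by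
  intro e
  have := (h n (-n) (by
    rw [zpow_neg, zpow_natCast, zpow_natCast, e, mul_inv_cancel₀ (pow_ne_zero _ hs)])).1
  exact hn (by exact_mod_cast this)

theorem Generic.sub_ne_zero (h : Generic r s) (hs : s ≠ 0) : r - s ≠ 0 :=
  _root_.sub_ne_zero.2 (by simpa using h.pow_ne hs one_ne_zero)

theorem Generic.sq_sub_sq_ne_zero (h : Generic r s) (hs : s ≠ 0) : r ^ 2 - s ^ 2 ≠ 0 :=
  _root_.sub_ne_zero.2 (h.pow_ne hs two_ne_zero)

theorem Generic.cube_sub_cube_ne_zero (h : Generic r s) (hs : s ≠ 0) : r ^ 3 - s ^ 3 ≠ 0 :=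
  _root_.sub_ne_zero.2 (h.pow_ne hs three_ne_zero)

theorem Generic.add_ne_zero (h : Generic r s) (hs : s ≠ 0) : r + s ≠ 0 := fun e =>
  h.pow_ne hs two_ne_zero (by linear_combination (r - s) * e)

theorem Generic.sq_add_sq_ne_zero (h : Generic r s) (hs : s ≠ 0) : r ^ 2 + s ^ 2 ≠ 0 := fun e =>
  h.pow_ne hs four_ne_zero (by linear_combination (r ^ 2 - s ^ 2) * e)

theorem Generic.sq_sub_add_sq_ne_zero (h : Generic r s) (hs : s ≠ 0) :
    r ^ 2 - r * s + s ^ 2 ≠ 0 := fun e =>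
  h.pow_ne hs (n := 6) (by norm_num) (by linear_combination (r ^ 3 - s ^ 3) * (r + s) * e)

theorem Generic.sq_add_add_sq_ne_zero (h : Generic r s) (hs : s ≠ 0) :
    r ^ 2 + r * s + s ^ 2 ≠ 0 := fun e =>
  h.pow_ne hs three_ne_zero (by linear_combination (r - s) * e)

/-- Within each root vector the leading term is already decided by coordinate 0; the lexicographic
order only makes the lattice totally ordered. -/
theorem lt_of_ofLex_zero_lt {v w : QLattice} (h : ofLex v 0 < ofLex w 0) : v < w :=
  ⟨0, fun j hj => absurd hj (Fin.not_lt_zero j), h⟩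

section Leads

variable (hr : r ≠ 0) (hs : s ≠ 0)

theorem feigin_map_rootV11 : feigin hr hs (rootV11 s (e₁ r s) (e₂ r s)) =
    rootV11 s (qm r s (letterExp 0) + qm r s (letterExp 2) + qm r s (letterExp 4))
      (qm r s (letterExp 1) + qm r s (letterExp 3) + qm r s (letterExp 5)) := by
  simp only [rootV11, map_sub, map_mul, map_smul, feigin, lift_e₁, lift_e₂]

theorem feigin_map_rootV21 : feigin hr hs (rootV21 r s (e₁ r s) (e₂ r s)) =
    rootV21 r s (qm r s (letterExp 0) + qm r s (letterExp 2) + qm r s (letterExp 4))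
      (qm r s (letterExp 1) + qm r s (letterExp 3) + qm r s (letterExp 5)) := by
  rw [rootV21, map_sub, map_mul, map_smul, map_mul, feigin_map_rootV11, feigin, lift_e₁, rootV21]

theorem feigin_map_rootV31 : feigin hr hs (rootV31 r s (e₁ r s) (e₂ r s)) =
    rootV31 r s (qm r s (letterExp 0) + qm r s (letterExp 2) + qm r s (letterExp 4))
      (qm r s (letterExp 1) + qm r s (letterExp 3) + qm r s (letterExp 5)) := by
  rw [rootV31, map_sub, map_mul, map_smul, map_mul, feigin_map_rootV21, feigin, lift_e₁, rootV31]

theorem feigin_map_rootV32 : feigin hr hs (rootV32 r s (e₁ r s) (e₂ r s)) =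
    rootV32 r s (qm r s (letterExp 0) + qm r s (letterExp 2) + qm r s (letterExp 4))
      (qm r s (letterExp 1) + qm r s (letterExp 3) + qm r s (letterExp 5)) := by
  rw [rootV32, map_sub, map_mul, map_smul, map_mul, feigin_map_rootV21, feigin_map_rootV11, rootV32]

include hr hs in
theorem hasLead_letter (i : Fin 8) : HasLead (qm r s (letterExp i)) (toLex (letterExp i)) :=
  hasLead_qm hr hs _

theorem hasLead_e₁ : HasLead (feigin hr hs (e₁ r s)) (toLex (letterExp 0)) := by
  rw [feigin, lift_e₁]
  refine ((hasLead_letter hr hs 0).add_of_lt (hasLead_letter hr hs 2) ?_).add_of_lt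
    (hasLead_letter hr hs 4) ?_ <;> exact lt_of_ofLex_zero_lt
    (by simp only [ofLex_toLex]; decide)

theorem hasLead_e₂ : HasLead (feigin hr hs (e₂ r s)) (toLex (letterExp 5)) := by
  rw [feigin, lift_e₂, add_comm, add_comm (qm r s (letterExp 1))]
  refine (hasLead_letter hr hs 5).add_of_lt ((hasLead_letter hr hs 3).add_of_lt
    (hasLead_letter hr hs 1) ?_) ?_ <;> exact lt_of_ofLex_zero_lt
    (by simp only [ofLex_toLex]; decide)

variable (h : Generic r s)
include h

theorem hasLead_rootV11 : HasLead (feigin hr hs (rootV11 s (e₁ r s) (e₂ r s)))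
    (toLex (letterExp 3 + letterExp 4)) := by
  rw [feigin_map_rootV11, (qAffine_letters hr hs).rootV11_eq hr hs]
  have x (i : Fin 8) := hasLead_letter (r := r) (s := s) hr hs i
  refine ((((x 3).mul (x 4)).add_of_lt ((x 1).mul (x 4)) ?_).add_of_lt ((x 1).mul (x 2)) ?_).smul
    (h.cube_sub_cube_ne_zero hs) <;>
  exact lt_of_ofLex_zero_lt
    (by simp only [ofLex_add, ofLex_toLex, Pi.add_apply]; decide)

theorem hasLead_rootV21 : HasLead (feigin hr hs (rootV21 r s (e₁ r s) (e₂ r s)))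
    (toLex (letterExp 3 + (letterExp 4 + letterExp 4))) := by
  rw [feigin_map_rootV21, (qAffine_letters hr hs).rootV21_eq hr hs]
  have x (i : Fin 8) := hasLead_letter (r := r) (s := s) hr hs i
  refine (((((x 3).mul ((x 4).mul (x 4))).smul hr).add_of_lt
    (((x 1).mul ((x 4).mul (x 4))).smul hr) ?_).add_of_lt
    (((x 1).mul ((x 2).mul (x 4))).smul (h.add_ne_zero hs)) ?_).add_of_lt
    (((x 1).mul ((x 2).mul (x 2))).smul hr) ?_ |>.smul
    (mul_ne_zero (h.cube_sub_cube_ne_zero hs) (h.sq_sub_sq_ne_zero hs)) <;>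
  exact lt_of_ofLex_zero_lt
    (by simp only [ofLex_add, ofLex_toLex, Pi.add_apply]; decide)

theorem hasLead_rootV31 : HasLead (feigin hr hs (rootV31 r s (e₁ r s) (e₂ r s)))
    (toLex (letterExp 1 + (letterExp 2 + (letterExp 2 + letterExp 2)))) := by
  rw [feigin_map_rootV31, (qAffine_letters hr hs).rootV31_eq hr hs]
  have x (i : Fin 8) := hasLead_letter (r := r) (s := s) hr hs i
  refine ((((((x 1).mul ((x 2).mul ((x 2).mul (x 2)))).smul (pow_ne_zero 2 hr)).add_of_lt
    (((x 3).mul ((x 4).mul ((x 4).mul (x 4)))).smul (pow_ne_zero 2 hr)) ?_).add_of_lt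
    (((x 1).mul ((x 4).mul ((x 4).mul (x 4)))).smul (pow_ne_zero 2 hr)) ?_).add_of_lt
    (((x 1).mul ((x 2).mul ((x 2).mul (x 4)))).smul (h.sq_add_add_sq_ne_zero hs)) ?_).add_of_lt
    (((x 1).mul ((x 2).mul ((x 4).mul (x 4)))).smul (h.sq_add_add_sq_ne_zero hs)) ?_ |>.smul
    (mul_ne_zero (mul_ne_zero (mul_ne_zero (h.cube_sub_cube_ne_zero hs) (h.sq_sub_sq_ne_zero hs))
      (h.sub_ne_zero hs)) hr) <;>
  exact lt_of_ofLex_zero_lt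
    (by simp only [ofLex_add, ofLex_toLex, Pi.add_apply]; decide)

theorem hasLead_rootV32 : HasLead (feigin hr hs (rootV32 r s (e₁ r s) (e₂ r s)))
    (toLex (letterExp 1 + (letterExp 2 + (letterExp 2 + (letterExp 3 + letterExp 4))))) := by
  rw [feigin_map_rootV32, (qAffine_letters hr hs).rootV32_eq hr hs]
  have x (i : Fin 8) := hasLead_letter (r := r) (s := s) hr hs i
  exact ((x 1).mul ((x 2).mul ((x 2).mul ((x 3).mul (x 4))))).smul
    (div_ne_zero (mul_ne_zero (mul_ne_zero (pow_ne_zero 2 (h.cube_sub_cube_ne_zero hs))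
      (h.sq_sub_sq_ne_zero hs)) (h.sub_ne_zero hs)) (mul_ne_zero (pow_ne_zero 2 hr) hs))

omit h in
theorem hasLead_torusMon (p : ℤ × ℤ) :
    HasLead (feigin hr hs (torusMon (k₁ r s) (k₂ r s) p : AugBorel r s))
      (p.1 • toLex (letterExp 6) + p.2 • toLex (letterExp 7)) := by
  have hk : Units.map (feigin hr hs : AugBorel r s →* _) (k₁ r s) = torusK hr hs :=
    Units.ext (lift_k₁ _ _)
  have hl : Units.map (feigin hr hs : AugBorel r s →* _) (k₂ r s) = torusL hr hs :=
    Units.ext (lift_k₂ _ _)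
  have : feigin hr hs (torusMon (k₁ r s) (k₂ r s) p : AugBorel r s) =
      ((torusK hr hs ^ p.1 * torusL hr hs ^ p.2 : (Module.End ℂ (QLattice →₀ ℂ))ˣ) :
        Module.End ℂ (QLattice →₀ ℂ)) := by
    rw [← hk, ← hl, ← map_zpow, ← map_zpow, ← map_mul]
    rfl
  rw [this, Units.val_mul]
  exact (hasLead_qmUnit_zpow hr hs _ _ _ _).mul (hasLead_qmUnit_zpow hr hs _ _ _ _)

/-- The leading exponent of an ordered monomial. -/
def pbwLead (p : PBWIndex) : QLattice :=
  toLex (p.1 • letterExp 0 +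
    (p.2.1 • (letterExp 1 + (letterExp 2 + (letterExp 2 + letterExp 2))) +
    (p.2.2.1 • (letterExp 3 + (letterExp 4 + letterExp 4)) +
    (p.2.2.2.1 • (letterExp 1 + (letterExp 2 + (letterExp 2 + (letterExp 3 + letterExp 4)))) +
    (p.2.2.2.2.1 • (letterExp 3 + letterExp 4) + (p.2.2.2.2.2.1 • letterExp 5 +
    (p.2.2.2.2.2.2.1 • letterExp 6 + p.2.2.2.2.2.2.2 • letterExp 7)))))))

theorem hasLead_pbw (p : PBWIndex) :
    HasLead (feigin hr hs (pbw r s (e₁ r s) (e₂ r s) (k₁ r s) (k₂ r s) p)) (pbwLead p) := by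
  simp only [pbw, map_mul, map_pow]
  exact ((hasLead_e₁ hr hs).pow _).mul <| ((hasLead_rootV31 hr hs h).pow _).mul <|
    ((hasLead_rootV21 hr hs h).pow _).mul <| ((hasLead_rootV32 hr hs h).pow _).mul <|
    ((hasLead_rootV11 hr hs h).pow _).mul <| ((hasLead_e₂ hr hs).pow _).mul <|
    hasLead_torusMon hr hs _

end Leads

/-- Coordinates 1 to 8 suffice: the eight leading exponents form a unimodular system there. -/
theorem pbwLead_injective : Function.Injective pbwLead := by
  rintro ⟨a₁, a₂, a₃, a₄, a₅, a₆, i, j⟩ ⟨b₁, b₂, b₃, b₄, b₅, b₆, i', j'⟩ h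
  have h (t : Fin 9) := congrFun (congrArg ofLex h) t
  have h1 := h 1
  have h2 := h 2
  have h3 := h 3
  have h4 := h 4
  have h5 := h 5
  have h6 := h 6
  have h7 := h 7
  have h8 := h 8
  simp [pbwLead, letterExp, -nsmul_eq_mul, -zsmul_eq_mul] at h1 h2 h3 h4 h5 h6 h7 h8
  simp only [Prod.mk.injEq]
  omega

/-! ### PBW basis and absence of zero divisors -/

section Domain

variable (hr : r ≠ 0) (hs : s ≠ 0) (h : Generic r s)
include hr hs h

theorem exists_pbw_sum (x : AugBorel r s) : ∃ c : PBWIndex →₀ ℂ,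
    (c.sum fun p t => t • pbw r s (e₁ r s) (e₂ r s) (k₁ r s) (k₂ r s) p) = x :=
  Finsupp.mem_span_range_iff_exists_finsupp.1 <| by
    rw [span_pbw hr hs (h.add_ne_zero hs) (h.sq_add_sq_ne_zero hs) (h.sq_sub_add_sq_ne_zero hs)]
    trivial

theorem exists_hasLead_feigin {x : AugBorel r s} (hx : x ≠ 0) : ∃ g, HasLead (feigin hr hs x) g := by
  obtain ⟨c, rfl⟩ := exists_pbw_sum hr hs h x
  have hc : c ≠ 0 := by rintro rfl; simp at hx
  obtain ⟨i, -, hi⟩ := HasLead.exists_sum (hasLead_pbw hr hs h) pbwLead_injective c hc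
  refine ⟨pbwLead i, ?_⟩
  rw [Finsupp.sum, map_sum]
  simp only [map_smul]
  exact hi

theorem linearIndependent_pbw :
    LinearIndependent ℂ (pbw r s (e₁ r s) (e₂ r s) (k₁ r s) (k₂ r s)) := by
  rw [linearIndependent_iff]
  intro c hc
  by_contra hne
  obtain ⟨i, -, hi⟩ := HasLead.exists_sum (hasLead_pbw hr hs h) pbwLead_injective c hne
  refine hi.ne_zero ?_
  rw [Finsupp.linearCombination_apply] at hc
  simpa only [Finsupp.sum, map_sum, map_smul, map_zero] using congrArg (feigin hr hs) hc

/-- Every nonzero element acts with a leading exponent, since its ordered monomials have distinct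
ones, and leading exponents add under composition. -/
theorem noZeroDivisors : NoZeroDivisors (AugBorel r s) where
  eq_zero_or_eq_zero_of_mul_eq_zero {x y} hxy := by
    by_contra! hne
    obtain ⟨g, hg⟩ := exists_hasLead_feigin hr hs h hne.1
    obtain ⟨g', hg'⟩ := exists_hasLead_feigin hr hs h hne.2
    refine (hg.mul hg').ne_zero ?_
    rw [← map_mul, hxy, map_zero]

omit h in
theorem nontrivial : Nontrivial (AugBorel r s) :=
  (feigin hr hs).toRingHom.domain_nontrivial

end Domain

theorem SerrePair.map {r s : ℂ} {A B : Type*} [Ring A] [Algebra ℂ A] [Ring B] [Algebra ℂ B]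
    {a b : A} (h : SerrePair r s a b) (f : A →ₐ[ℂ] B) : SerrePair r s (f a) (f b) where
  serre_b := by
    simpa only [map_mul, map_add, map_sub, map_smul, map_pow, map_zero] using congrArg f h.serre_b
  serre_a := by
    simpa only [map_mul, map_add, map_sub, map_smul, map_pow, map_zero] using congrArg f h.serre_a

/-- The two relations are homogeneous of total degrees 3 and 5, so a factor z commuting with both
elements comes out as z³ or z⁵. It is applied with z the polynomial variable. -/
theorem SerrePair.mul_central {r s : ℂ} {A : Type*} [Ring A] [Algebra ℂ A] {a b z : A}
    (h : SerrePair r s a b) (ha : z * a = a * z) (hb : z * b = b * z) :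
    SerrePair r s (a * z) (b * z) where
  serre_b := by
    have := congrArg (· * (z * (z * z))) h.serre_b
    simp only [pow_succ, pow_zero, one_mul, mul_mul_of_eq ha, mul_mul_of_eq hb,
      add_mul (R := A), sub_mul (α := A), smul_mul_assoc, mul_assoc (G := A), zero_mul] at this ⊢
    exact this
  serre_a := by
    have := congrArg (· * (z * (z * (z * (z * z))))) h.serre_a
    simp only [pow_succ, pow_zero, one_mul, mul_mul_of_eq ha, mul_mul_of_eq hb,
      add_mul (R := A), sub_mul (α := A), smul_mul_assoc, mul_assoc (G := A), zero_mul] at this ⊢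
    exact this

theorem TorusAction.map {r s : ℂ} {A B : Type*} [Ring A] [Algebra ℂ A] [Ring B] [Algebra ℂ B]
    {a b : A} {k l : Aˣ} (h : TorusAction r s a b k l) (f : A →ₐ[ℂ] B) :
    TorusAction r s (f a) (f b) (Units.map (f : A →* B) k) (Units.map (f : A →* B) l) where
  comm := by
    have := congrArg f h.comm
    simp only [map_mul] at this
    exact this
  k_a := by
    have := congrArg f h.k_a
    simp only [map_mul, map_smul] at this
    exact this
  k_b := by
    have := congrArg f h.k_b
    simp only [map_mul, map_smul] at this
    exact this
  l_a := by
    have := congrArg f h.l_a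
    simp only [map_mul, map_smul] at this
    exact this
  l_b := by
    have := congrArg f h.l_b
    simp only [map_mul, map_smul] at this
    exact this

theorem TorusAction.mul_central {r s : ℂ} {A : Type*} [Ring A] [Algebra ℂ A] {a b z : A} {k l : Aˣ}
    (h : TorusAction r s a b k l) (hk : z * k = k * z) (hl : z * l = l * z) :
    TorusAction r s (a * z) (b * z) k l where
  comm := h.comm
  k_a := by rw [← mul_assoc, h.k_a, smul_mul_assoc, mul_assoc, mul_assoc, hk]
  k_b := by rw [← mul_assoc, h.k_b, smul_mul_assoc, mul_assoc, mul_assoc, hk]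
  l_a := by rw [← mul_assoc, h.l_a, smul_mul_assoc, mul_assoc, mul_assoc, hl]
  l_b := by rw [← mul_assoc, h.l_b, smul_mul_assoc, mul_assoc, mul_assoc, hl]

variable {r s : ℂ}

theorem map_units_inv {A B : Type*} [Ring A] [Algebra ℂ A] [Ring B] [Algebra ℂ B] (f : A →ₐ[ℂ] B)
    {u : Aˣ} {v : Bˣ} (h : f u = v) : f (u⁻¹ : Aˣ) = (v⁻¹ : Bˣ) := by
  have : Units.map (f : A →* B) u = v := Units.ext h
  rw [← this]
  rfl

theorem algHom_ext {A : Type*} [Ring A] [Algebra ℂ A] {f g : AugBorel r s →ₐ[ℂ] A}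
    (h₁ : f (e₁ r s) = g (e₁ r s)) (h₂ : f (e₂ r s) = g (e₂ r s))
    (hk : f (k₁ r s : AugBorel r s) = g (k₁ r s : AugBorel r s))
    (hl : f (k₂ r s : AugBorel r s) = g (k₂ r s : AugBorel r s)) : f = g := by
  have hinv {u : (AugBorel r s)ˣ} (hu : f u = g u) :
      f (u⁻¹ : (AugBorel r s)ˣ) = g (u⁻¹ : (AugBorel r s)ˣ) :=
    map_units_inv f (v := Units.map (g : AugBorel r s →* A) u) hu
  have := subalgebra_eq_top (B := AlgHom.equalizer f g) h₁ h₂ hk (hinv hk) hl (hinv hl)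
  ext x
  have hx : x ∈ AlgHom.equalizer f g := this ▸ Algebra.mem_top
  exact hx

/-! ### Grading by height -/

section Grading

open Polynomial

/-- The homomorphism `e_i ↦ e_i X`, `k_i ↦ k_i`, recording the grading by height. -/
noncomputable def heightHom (r s : ℂ) : AugBorel r s →ₐ[ℂ] (AugBorel r s)[X] :=
  lift (((serrePair r s).map (Polynomial.CAlgHom (R := ℂ))).mul_central (X_mul_C _) (X_mul_C _))
    (((torusAction r s).map (Polynomial.CAlgHom (R := ℂ))).mul_central (X_mul_C _) (X_mul_C _))

/-- Evaluation at a central element. -/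
noncomputable def evalHom (c : ℂ) : (AugBorel r s)[X] →ₐ[ℂ] AugBorel r s :=
  Polynomial.eval₂AlgHom (AlgHom.id ℂ _) (algebraMap ℂ _ c)
    fun a => (Algebra.commutes c a).symm

theorem evalHom_C (c : ℂ) (a : AugBorel r s) : evalHom c (C a) = a :=
  Polynomial.eval₂_C _ _

theorem evalHom_one_heightHom (x : AugBorel r s) : evalHom 1 (heightHom r s x) = x := by
  have : (evalHom 1).comp (heightHom r s) = AlgHom.id ℂ (AugBorel r s) := by
    apply algHom_ext <;> simp [evalHom, heightHom]
  exact DFunLike.congr_fun this x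

/-- Setting X = 0 kills `e₁` and `e₂` and fixes the torus, so this is the projection to height zero.
-/
theorem evalHom_zero_heightHom (x : AugBorel r s) : evalHom 0 (heightHom r s x) ∈
    Algebra.adjoin ℂ (Set.range fun p => (torusMon (k₁ r s) (k₂ r s) p : AugBorel r s)) := by
  set T := Algebra.adjoin ℂ (Set.range fun p => (torusMon (k₁ r s) (k₂ r s) p : AugBorel r s))
  set f := (evalHom 0).comp (heightHom r s)
  have hT (p : ℤ × ℤ) : (torusMon (k₁ r s) (k₂ r s) p : AugBorel r s) ∈ T :=
    Algebra.subset_adjoin ⟨p, rfl⟩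
  have hk : f (k₁ r s : AugBorel r s) = (k₁ r s : AugBorel r s) := by
    simp [f, evalHom, heightHom]
  have hl : f (k₂ r s : AugBorel r s) = (k₂ r s : AugBorel r s) := by
    simp [f, evalHom, heightHom]
  have : T.comap f = ⊤ := by
    refine subalgebra_eq_top ?_ ?_ ?_ ?_ ?_ ?_ <;> rw [Subalgebra.mem_comap]
    · simp [f, evalHom, heightHom]
    · simp [f, evalHom, heightHom]
    · rw [hk]; simpa [torusMon] using hT (1, 0)
    · rw [map_units_inv f hk]; simpa [torusMon] using hT (-1, 0)
    · rw [hl]; simpa [torusMon] using hT (0, 1)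
    · rw [map_units_inv f hl]; simpa [torusMon] using hT (0, -1)
  have hx : x ∈ T.comap f := this ▸ Algebra.mem_top
  exact hx

end Grading

/-! ### Units are scalar multiples of torus monomials -/

section Units

/-- If the product of the support sizes exceeded one, two different pairs would have unique sums,
and each such sum would carry a nonzero coefficient of the product. Both sums would then be 0,
contradicting uniqueness. -/
theorem eq_single_of_mul_eq_one {k G : Type*} [Field k] [AddGroup G] [TwoUniqueSums G]
    {f g : AddMonoidAlgebra k G} (h : f * g = 1) : ∃ a c, f = AddMonoidAlgebra.single a c := by
  classical
  have hf : f.coeff.support.Nonempty := by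
    rw [Finsupp.support_nonempty_iff]
    intro h0
    rw [AddMonoidAlgebra.coeff_eq_zero.1 h0, zero_mul] at h
    exact zero_ne_one h
  have hg : g.coeff.support.Nonempty := by
    rw [Finsupp.support_nonempty_iff]
    intro h0
    rw [AddMonoidAlgebra.coeff_eq_zero.1 h0, mul_zero] at h
    exact zero_ne_one h
  have hcard : ¬ 1 < f.coeff.support.card * g.coeff.support.card := by
    intro hlt
    obtain ⟨p, hp, q, hq, hpq, up, uq⟩ := TwoUniqueSums.uniqueAdd_of_one_lt_card hlt
    have key {x : G × G} (hx : x ∈ f.coeff.support ×ˢ g.coeff.support)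
        (ux : UniqueAdd f.coeff.support g.coeff.support x.1 x.2) : x.1 + x.2 = 0 := by
      by_contra hne
      have := AddMonoidAlgebra.coeff_mul_add_of_uniqueAdd ux
      rw [h, AddMonoidAlgebra.one_def, AddMonoidAlgebra.coeff_single,
        Finsupp.single_eq_of_ne hne] at this
      rw [Finset.mem_product, Finsupp.mem_support_iff, Finsupp.mem_support_iff] at hx
      exact mul_ne_zero hx.1 hx.2 this.symm
    have h₁ := key hp up
    have h₂ := key hq uq
    rw [Finset.mem_product] at hq
    have := up hq.1 hq.2 (h₂.trans h₁.symm)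
    exact hpq (Prod.ext this.1.symm this.2.symm)
  have : f.coeff.support.card ≤ 1 := by
    have := Finset.card_pos.2 hg
    have := Finset.card_pos.2 hf
    nlinarith
  obtain ⟨a, ha⟩ := Finsupp.card_support_le_one.1 this
  exact ⟨a, _, AddMonoidAlgebra.coeff_injective (by simpa using ha)⟩

/-- The subalgebra of `AugBorel` generated by the torus is a quotient of a Laurent polynomial
ring. -/
noncomputable def laurentHom (r s : ℂ) : AddMonoidAlgebra ℂ (ℤ × ℤ) →ₐ[ℂ] AugBorel r s :=
  AddMonoidAlgebra.lift ℂ (AugBorel r s) (ℤ × ℤ)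
    { toFun := fun p => (torusMon (k₁ r s) (k₂ r s) p.toAdd : AugBorel r s)
      map_one' := by simp [torusMon]
      map_mul' := fun p q => by
        rw [toAdd_mul, torusMon_mul (torusAction r s).comm, Units.val_mul] }

theorem laurentHom_apply (f : AddMonoidAlgebra ℂ (ℤ × ℤ)) : laurentHom r s f =
    f.coeff.sum fun p t => t • (torusMon (k₁ r s) (k₂ r s) p : AugBorel r s) :=
  AddMonoidAlgebra.lift_apply _ _

theorem exists_laurentHom_eq {x : AugBorel r s} (hx : x ∈
    Algebra.adjoin ℂ (Set.range fun p => (torusMon (k₁ r s) (k₂ r s) p : AugBorel r s))) :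
    ∃ f, laurentHom r s f = x := by
  rw [← Subalgebra.mem_toSubmodule, adjoin_range_torusMon (torusAction r s).comm,
    Finsupp.mem_span_range_iff_exists_finsupp] at hx
  obtain ⟨c, hc⟩ := hx
  exact ⟨.ofCoeff c, by rw [laurentHom_apply]; exact hc⟩

variable (hr : r ≠ 0) (hs : s ≠ 0) (h : Generic r s)
include hr hs h

theorem laurentHom_injective : Function.Injective (laurentHom r s) := by
  have hli := (linearIndependent_pbw hr hs h).comp
    (fun p : ℤ × ℤ => ((0, 0, 0, 0, 0, 0, p) : PBWIndex)) (fun p q hpq => by simpa using hpq)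
  rw [injective_iff_map_eq_zero]
  intro f hf
  rw [linearIndependent_iff] at hli
  refine AddMonoidAlgebra.coeff_eq_zero.1 (hli f.coeff ?_)
  rw [laurentHom_apply] at hf
  rw [Finsupp.linearCombination_apply, ← hf]
  simp [pbw]

/-- The units of `AugBorel` are the scalar multiples of the monomials in `k₁` and `k₂`. -/
theorem eq_smul_torusMon_of_mul_eq_one {u v : AugBorel r s} (huv : u * v = 1) :
    ∃ (c : ℂ) (p : ℤ × ℤ), c ≠ 0 ∧ u = c • (torusMon (k₁ r s) (k₂ r s) p : AugBorel r s) := by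
  have := noZeroDivisors hr hs h
  have := nontrivial hr hs
  have hmem {x y : AugBorel r s} (hxy : x * y = 1) : x ∈
      Algebra.adjoin ℂ (Set.range fun p => (torusMon (k₁ r s) (k₂ r s) p : AugBorel r s)) ∧
      y ∈ Algebra.adjoin ℂ (Set.range fun p => (torusMon (k₁ r s) (k₂ r s) p : AugBorel r s)) := by
    have hD : heightHom r s x * heightHom r s y = 1 := by rw [← map_mul, hxy, map_one]
    have hx0 : heightHom r s x ≠ 0 := left_ne_zero_of_mul_eq_one hD
    have hy0 : heightHom r s y ≠ 0 := right_ne_zero_of_mul_eq_one hD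
    have hdeg := congrArg Polynomial.natDegree hD
    rw [Polynomial.natDegree_mul hx0 hy0, Polynomial.natDegree_one, Nat.add_eq_zero_iff] at hdeg
    have key {z : AugBorel r s} (hz : (heightHom r s z).natDegree = 0) : z ∈
        Algebra.adjoin ℂ (Set.range fun p => (torusMon (k₁ r s) (k₂ r s) p : AugBorel r s)) := by
      -- A constant polynomial has the same value at 1, which is z, and at 0, which lies in the
      -- torus subalgebra.
      have h₁ := evalHom_one_heightHom z
      have h₀ := evalHom_zero_heightHom z
      rw [Polynomial.eq_C_of_natDegree_eq_zero hz] at h₀ h₁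
      rw [evalHom_C] at h₀ h₁
      rwa [h₁] at h₀
    exact ⟨key hdeg.1, key hdeg.2⟩
  obtain ⟨hu, hv⟩ := hmem huv
  obtain ⟨f, rfl⟩ := exists_laurentHom_eq hu
  obtain ⟨g, rfl⟩ := exists_laurentHom_eq hv
  rw [← map_mul, ← map_one (laurentHom r s)] at huv
  obtain ⟨p, c, rfl⟩ := eq_single_of_mul_eq_one (laurentHom_injective hr hs h huv)
  refine ⟨c, p, ?_, AddMonoidAlgebra.lift_single _ _ _⟩
  rintro rfl
  have := laurentHom_injective hr hs h huv
  simp at this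

end Units

/-! ### Weight spaces of the simple roots -/

variable {r s : ℂ}

theorem Generic.eq_of_zpow_mul_zpow_eq (h : Generic r s) (hr : r ≠ 0) (hs : s ≠ 0)
    {a b c d : ℤ} (e : r ^ a * s ^ b = r ^ c * s ^ d) : a = c ∧ b = d := by
  have := h (a - c) (b - d) (by
    rw [zpow_sub₀ hr, zpow_sub₀ hs, div_mul_div_comm, e,
      div_self (mul_ne_zero (zpow_ne_zero _ hr) (zpow_ne_zero _ hs))])
  omega

theorem chi₁_eq (hr : r ≠ 0) (hs : s ≠ 0) (m n : ℕ) :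
    chi₁ r s m n = r ^ (-m + 3 * n : ℤ) * s ^ (-2 * m + 3 * n : ℤ) := by
  simp only [chi₁, zpow_add₀ hr, zpow_add₀ hs, zpow_mul, zpow_natCast, mul_pow, zpow_neg, zpow_one,
    inv_pow]
  norm_cast
  ring

theorem chi₂_eq (hr : r ≠ 0) (hs : s ≠ 0) (m n : ℕ) :
    chi₂ r s m n = r ^ (-3 * m + 6 * n : ℤ) * s ^ (-3 * m + 3 * n : ℤ) := by
  simp only [chi₂, zpow_add₀ hr, zpow_add₀ hs, zpow_mul, zpow_natCast, mul_pow, zpow_neg,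
    inv_pow]
  norm_cast
  ring

theorem chi_zpow_eq (hr : r ≠ 0) (hs : s ≠ 0) (m n : ℕ) (i j : ℤ) :
    chi₁ r s m n ^ i * chi₂ r s m n ^ j =
      r ^ ((-m + 3 * n) * i + (-3 * m + 6 * n) * j) *
        s ^ ((-2 * m + 3 * n) * i + (-3 * m + 3 * n) * j) := by
  rw [chi₁_eq hr hs, chi₂_eq hr hs, mul_zpow, mul_zpow, ← zpow_mul, ← zpow_mul, ← zpow_mul,
    ← zpow_mul, zpow_add₀ hr, zpow_add₀ hs]
  ring

section Weights

variable (hr : r ≠ 0) (hs : s ≠ 0) (h : Generic r s)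
include hr hs h

/-- A weight vector is a combination of ordered monomials of the same weight. -/
theorem exists_pbw_sum_of_weight {x : AugBorel r s} {m n : ℕ}
    (hx : (k₁ r s : AugBorel r s) * x = chi₁ r s m n • (x * k₁ r s)) :
    ∃ c : PBWIndex →₀ ℂ,
      (c.sum fun p t => t • pbw r s (e₁ r s) (e₂ r s) (k₁ r s) (k₂ r s) p) = x ∧
      ∀ p ∈ c.support, p.deg₁ = m ∧ p.deg₂ = n := by
  obtain ⟨c, hc⟩ := exists_pbw_sum hr hs h x
  refine ⟨c, hc, fun p hp => ?_⟩
  have hz : (c.sum fun p t => (t * (chi₁ r s p.deg₁ p.deg₂ - chi₁ r s m n)) •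
      pbw r s (e₁ r s) (e₂ r s) (k₁ r s) (k₂ r s) p) * (k₁ r s : AugBorel r s) = 0 := by
    have : (k₁ r s : AugBorel r s) * x - chi₁ r s m n • (x * k₁ r s) = 0 := by
      rw [hx, sub_self]
    rw [← this, ← hc, Finsupp.sum, Finsupp.sum, Finset.sum_mul, Finset.mul_sum, Finset.sum_mul,
      Finset.smul_sum, ← Finset.sum_sub_distrib]
    refine Finset.sum_congr rfl fun q _ => ?_
    rw [mul_smul_comm, ((torusAction r s).hasWeight_pbw q).left, smul_mul_assoc, smul_mul_assoc,
      smul_smul, smul_smul, ← sub_smul]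
    congr 1
    ring
  rw [Units.mul_left_eq_zero] at hz
  have hp0 := linearIndependent_iff'.1 (linearIndependent_pbw hr hs h) c.support _ hz p hp
  have hχ : chi₁ r s p.deg₁ p.deg₂ = chi₁ r s m n :=
    sub_eq_zero.1 ((mul_eq_zero.1 hp0).resolve_left (Finsupp.mem_support_iff.1 hp))
  -- The element `k₁` alone separates weights: the exponents −m + 3n and −2m + 3n determine m and n.
  rw [chi₁_eq hr hs, chi₁_eq hr hs] at hχ
  have := h.eq_of_zpow_mul_zpow_eq hr hs hχ
  omega

/-- As α₁ is simple, a PBW monomial of this weight contains `e₁` once and no other root vector. -/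
theorem exists_eq_e₁_mul {x : AugBorel r s}
    (hx : (k₁ r s : AugBorel r s) * x = chi₁ r s 1 0 • (x * k₁ r s)) : ∃ t, x = e₁ r s * t := by
  obtain ⟨c, rfl, hc⟩ := exists_pbw_sum_of_weight hr hs h hx
  refine ⟨c.sum fun p t => t • (torusMon (k₁ r s) (k₂ r s) p.2.2.2.2.2.2 : AugBorel r s), ?_⟩
  rw [Finsupp.sum, Finsupp.sum, Finset.mul_sum]
  refine Finset.sum_congr rfl fun p hp => ?_
  have := hc p hp
  obtain ⟨a₁, a₂, a₃, a₄, a₅, a₆, q⟩ := p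
  simp only [PBWIndex.deg₁, PBWIndex.deg₂] at this
  obtain ⟨rfl, rfl, rfl, rfl, rfl, rfl⟩ :
    a₁ = 1 ∧ a₂ = 0 ∧ a₃ = 0 ∧ a₄ = 0 ∧ a₅ = 0 ∧ a₆ = 0 := by omega
  simp [pbw]

theorem exists_eq_e₂_mul {x : AugBorel r s}
    (hx : (k₁ r s : AugBorel r s) * x = chi₁ r s 0 1 • (x * k₁ r s)) : ∃ t, x = e₂ r s * t := by
  obtain ⟨c, rfl, hc⟩ := exists_pbw_sum_of_weight hr hs h hx
  refine ⟨c.sum fun p t => t • (torusMon (k₁ r s) (k₂ r s) p.2.2.2.2.2.2 : AugBorel r s), ?_⟩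
  rw [Finsupp.sum, Finsupp.sum, Finset.mul_sum]
  refine Finset.sum_congr rfl fun p hp => ?_
  have := hc p hp
  obtain ⟨a₁, a₂, a₃, a₄, a₅, a₆, q⟩ := p
  simp only [PBWIndex.deg₁, PBWIndex.deg₂] at this
  obtain ⟨rfl, rfl, rfl, rfl, rfl, rfl⟩ :
    a₁ = 0 ∧ a₂ = 0 ∧ a₃ = 0 ∧ a₄ = 0 ∧ a₅ = 0 ∧ a₆ = 1 := by omega
  simp [pbw]

theorem e₁_ne_zero : e₁ r s ≠ 0 := by
  simpa [pbw, torusMon] using (linearIndependent_pbw hr hs h).ne_zero (1, 0, 0, 0, 0, 0, 0, 0)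

theorem e₂_ne_zero : e₂ r s ≠ 0 := by
  simpa [pbw, torusMon] using (linearIndependent_pbw hr hs h).ne_zero (0, 0, 0, 0, 0, 1, 0, 0)

/-- `e₁ e₂` and `e₂ e₁` are linearly independent. -/
theorem eq_zero_of_smul_e₂_mul_e₁ {c d : ℂ}
    (hcd : c • (e₂ r s * e₁ r s) = d • (e₁ r s * e₂ r s)) : c = 0 := by
  have hli := (linearIndependent_pbw hr hs h).comp
    (![(1, 0, 0, 0, 0, 1, 0, 0), (0, 0, 0, 0, 1, 0, 0, 0)] : Fin 2 → PBWIndex)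
    (by intro i j; fin_cases i <;> fin_cases j <;> simp)
  -- The two basis elements are `e₁ * e₂` and `rootV11`. These coefficients combine them to s³ times
  -- the difference of the two sides of `hcd`.
  have := Fintype.linearIndependent_iff.1 hli ![s ^ 3 * d - c, c] (by
    simp only [Fin.sum_univ_two, Function.comp, Matrix.cons_val_zero, Matrix.cons_val_one, pbw,
      torusMon, zpow_zero, mul_one, one_mul, pow_zero, pow_one, Units.val_one, rootV11]
    linear_combination (norm := module) (-s ^ 3 : ℂ) • hcd) 1
  simpa using this

end Weights

/-! ### Identifying the images of the torus generators -/

section Torus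

/-- The two-dimensional representation of `AugBorel` with `e₁ ↦ 0` and `e₂ ↦ E₀₁`. -/
noncomputable def smallRep (hr : r ≠ 0) (hs : s ≠ 0) :
    AugBorel r s →ₐ[ℂ] Matrix (Fin 2) (Fin 2) ℂ :=
  lift (a := 0) (b := !![0, 1; 0, 0])
    (k := ⟨!![chi₁ r s 0 1, 0; 0, 1], !![(chi₁ r s 0 1)⁻¹, 0; 0, 1],
      by simp [Matrix.one_fin_two, chi₁_ne_zero hr hs],
      by simp [Matrix.one_fin_two, chi₁_ne_zero hr hs]⟩)
    (l := ⟨!![chi₂ r s 0 1, 0; 0, 1], !![(chi₂ r s 0 1)⁻¹, 0; 0, 1],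
      by simp [Matrix.one_fin_two, chi₂_ne_zero hr hs],
      by simp [Matrix.one_fin_two, chi₂_ne_zero hr hs]⟩)
    ⟨by simp, by simp⟩
    ⟨by simp [mul_comm], by simp, by simp [chi₁], by simp, by simp [chi₂]⟩

end Torus

variable {r s : ℂ}

section Torus

variable (hr : r ≠ 0) (hs : s ≠ 0)

theorem smallRep_one_zero (x : AugBorel r s) : smallRep hr hs x 1 0 = 0 := by
  let S : Subalgebra ℂ (AugBorel r s) :=
    { carrier := {x | smallRep hr hs x 1 0 = 0}
      mul_mem' := fun {x y} hx hy => by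
        simp only [Set.mem_ofPred_eq] at hx hy ⊢
        rw [map_mul, Matrix.mul_apply, Fin.sum_univ_two, hx, hy, zero_mul, mul_zero, add_zero]
      add_mem' := fun {x y} hx hy => by
        simp only [Set.mem_ofPred_eq] at hx hy ⊢
        rw [map_add, Matrix.add_apply, hx, hy, add_zero]
      algebraMap_mem' := fun c => by
        simp [Matrix.algebraMap_matrix_apply] }
  have hS : S = ⊤ := by
    refine subalgebra_eq_top ?_ ?_ ?_ ?_ ?_ ?_
    · simp [S, smallRep]
    · simp [S, smallRep]
    · simp [S, smallRep]
    · change smallRep hr hs _ 1 0 = 0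
      rw [smallRep, map_units_inv _ (lift_k₁ _ _)]
      rfl
    · simp [S, smallRep]
    · change smallRep hr hs _ 1 0 = 0
      rw [smallRep, map_units_inv _ (lift_k₂ _ _)]
      rfl
  have hx : x ∈ S := hS ▸ Algebra.mem_top
  exact hx

variable (h : Generic r s)
include h

theorem smallRep_zero_one_of_commute {x : AugBorel r s}
    (hx : Commute (k₁ r s : AugBorel r s) x) : smallRep hr hs x 0 1 = 0 := by
  have hk : smallRep hr hs (k₁ r s : AugBorel r s) = !![chi₁ r s 0 1, 0; 0, 1] :=
    lift_k₁ _ _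
  have e := congrFun (congrFun (congrArg (smallRep hr hs) hx.eq) 0) 1
  rw [map_mul, map_mul, hk] at e
  simp only [Matrix.mul_apply, Fin.sum_univ_two, Matrix.of_apply, Matrix.cons_val', Matrix.cons_val_zero,
    Matrix.cons_val_one, Matrix.cons_val_fin_one, zero_mul, mul_zero, add_zero, zero_add,
    mul_one] at e
  by_contra hne
  have h1 : chi₁ r s 0 1 = 1 := mul_right_cancel₀ hne (by rw [e, one_mul])
  rw [chi₁_eq hr hs] at h1
  have := h _ _ h1
  norm_num at this

/-- The `(0, 1)` entry of a weight vector of a torus monomial vanishes unless the weights agree. -/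
theorem smallRep_zero_one_eq_zero {x : AugBorel r s} {p : ℤ × ℤ} {m n : ℕ} {i j : ℤ}
    (hx : (torusMon (k₁ r s) (k₂ r s) p : AugBorel r s) * x =
      (chi₁ r s m n ^ i * chi₂ r s m n ^ j) • (x * torusMon (k₁ r s) (k₂ r s) p)) :
    smallRep hr hs x 0 1 = 0 ∨
      (3 * p.1 + 6 * p.2 = (-m + 3 * n) * i + (-3 * m + 6 * n) * j ∧
        3 * p.1 + 3 * p.2 = (-2 * m + 3 * n) * i + (-3 * m + 3 * n) * j) := by
  set K := smallRep hr hs (torusMon (k₁ r s) (k₂ r s) p : AugBorel r s) with hK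
  have hK01 : K 0 1 = 0 := smallRep_zero_one_of_commute hr hs h (by
    have := (hasWeight_torusMon (r := r) (s := s) (torusAction r s).comm p).left
    rwa [show chi₁ r s 0 0 = 1 by simp [chi₁], one_smul] at this)
  have hK10 : K 1 0 = 0 := smallRep_one_zero hr hs _
  have hb : smallRep hr hs (e₂ r s) = !![0, 1; 0, 0] := lift_e₂ _ _
  -- The (0, 1) entry of the relation for `e₂` says that K 0 0 is K 1 1 times the character of α₂ at
  -- p. A nonzero (0, 1) entry of x must therefore scale by the same character.
  have hK00 := congrFun (congrFun (congrArg (smallRep hr hs)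
    ((torusAction r s).hasWeight_b.torusMon_mul hr hs p)) 0) 1
  have hK11 : K 1 1 ≠ 0 := by
    have hinv := congrFun (congrFun (congrArg (smallRep hr hs)
      (Units.mul_inv (torusMon (k₁ r s) (k₂ r s) p))) 1) 1
    rw [map_mul, map_one, Matrix.mul_apply, Fin.sum_univ_two, ← hK, hK10, zero_mul, zero_add,
      Matrix.one_apply_eq] at hinv
    exact left_ne_zero_of_mul_eq_one hinv
  rw [map_mul, map_smul, map_mul, hb, ← hK] at hK00
  have e := congrFun (congrFun (congrArg (smallRep hr hs) hx) 0) 1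
  rw [map_mul, map_smul, map_mul, ← hK] at e
  simp only [Matrix.mul_apply, Matrix.smul_apply, Fin.sum_univ_two, Matrix.of_apply,
    Matrix.cons_val', Matrix.cons_val_zero, Matrix.cons_val_one, Matrix.cons_val_fin_one, zero_mul,
    mul_zero, add_zero, zero_add, mul_one, one_mul, smul_eq_mul, hK01] at e hK00
  refine or_iff_not_imp_left.2 fun hne => ?_
  have hχ : chi₁ r s 0 1 ^ p.1 * chi₂ r s 0 1 ^ p.2 = chi₁ r s m n ^ i * chi₂ r s m n ^ j := by
    refine mul_right_cancel₀ (mul_ne_zero hK11 hne) ?_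
    linear_combination e - smallRep hr hs x 0 1 * hK00
  rw [chi_zpow_eq hr hs, chi_zpow_eq hr hs] at hχ
  have := h.eq_of_zpow_mul_zpow_eq hr hs hχ
  push_cast at this
  constructor
  · linarith [this.1]
  · linarith [this.2]

include hr hs in
/-- An automorphism permuting the torus monomials up to scalars fixes them up to scalars. -/
theorem torusMon_eq_of_algEquiv (θ : AugBorel r s ≃ₐ[ℂ] AugBorel r s) {c d : ℂ} {p q : ℤ × ℤ}
    (hc : c ≠ 0) (hd : d ≠ 0)
    (hk : θ (k₁ r s : AugBorel r s) = c • (torusMon (k₁ r s) (k₂ r s) p : AugBorel r s))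
    (hl : θ (k₂ r s : AugBorel r s) = d • (torusMon (k₁ r s) (k₂ r s) q : AugBorel r s)) :
    p = (1, 0) ∧ q = (0, 1) := by
  have cancel {t χ : ℂ} {x y : AugBorel r s} (ht : t ≠ 0)
      (e : (t • x) * y = χ • (y * (t • x))) : x * y = χ • (y * x) := by
    rw [smul_mul_assoc, mul_smul_comm, smul_comm] at e
    exact smul_right_injective _ ht e
  have wk {x : AugBorel r s} {m n : ℕ} (hx : HasWeight r s (k₁ r s) (k₂ r s) x m n) :
      (torusMon (k₁ r s) (k₂ r s) p : AugBorel r s) * θ x =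
      (chi₁ r s m n ^ (1 : ℤ) * chi₂ r s m n ^ (0 : ℤ)) •
        (θ x * torusMon (k₁ r s) (k₂ r s) p) := by
    refine cancel hc ?_
    rw [← hk, ← map_mul, hx.left, map_smul, map_mul, zpow_one, zpow_zero, mul_one]
  have wl {x : AugBorel r s} {m n : ℕ} (hx : HasWeight r s (k₁ r s) (k₂ r s) x m n) :
      (torusMon (k₁ r s) (k₂ r s) q : AugBorel r s) * θ x =
      (chi₁ r s m n ^ (0 : ℤ) * chi₂ r s m n ^ (1 : ℤ)) •
        (θ x * torusMon (k₁ r s) (k₂ r s) q) := by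
    refine cancel hd ?_
    rw [← hl, ← map_mul, hx.right, map_smul, map_mul, zpow_one, zpow_zero, one_mul]
  have hT := torusAction r s
  -- Otherwise 3 p.1 + 6 p.2 = −1, impossible modulo 3.
  have he₁ : smallRep hr hs (θ (e₁ r s)) 0 1 = 0 :=
    (smallRep_zero_one_eq_zero hr hs h (wk hT.hasWeight_a)).resolve_right (by push_cast; omega)
  -- If this entry vanished too, it would vanish on the image of θ, which is the whole algebra and
  -- contains `e₂`.
  have he₂ : smallRep hr hs (θ (e₂ r s)) 0 1 ≠ 0 := by
    intro he₂
    let S : Subalgebra ℂ (AugBorel r s) :=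
      { carrier := {x | smallRep hr hs (θ x) 0 1 = 0}
        mul_mem' := fun {x y} hx hy => by
          simp only [Set.mem_ofPred_eq] at hx hy ⊢
          rw [map_mul, map_mul, Matrix.mul_apply, Fin.sum_univ_two, hx, hy, zero_mul, mul_zero,
            add_zero]
        add_mem' := fun {x y} hx hy => by
          simp only [Set.mem_ofPred_eq] at hx hy ⊢
          rw [map_add, map_add, Matrix.add_apply, hx, hy, add_zero]
        algebraMap_mem' := fun c => by
          simp [Matrix.algebraMap_matrix_apply] }
    have hcomm (t : ℂ) (p : ℤ × ℤ) :
        Commute (k₁ r s : AugBorel r s) (t • (torusMon (k₁ r s) (k₂ r s) p : AugBorel r s)) := by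
      have := (hasWeight_torusMon (r := r) (s := s) hT.comm p).left
      rw [show chi₁ r s 0 0 = 1 by simp [chi₁], one_smul] at this
      exact Commute.smul_right this t
    have hinv {u : (AugBorel r s)ˣ} (hu : Commute (k₁ r s : AugBorel r s) (θ u)) :
        Commute (k₁ r s : AugBorel r s) (θ (u⁻¹ : (AugBorel r s)ˣ)) :=
      Commute.units_inv_right (u := Units.map (θ : AugBorel r s →* AugBorel r s) u) hu
    have hck : Commute (k₁ r s : AugBorel r s) (θ (k₁ r s : AugBorel r s)) := hk ▸ hcomm _ _
    have hcl : Commute (k₁ r s : AugBorel r s) (θ (k₂ r s : AugBorel r s)) := hl ▸ hcomm _ _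
    have hS : S = ⊤ := subalgebra_eq_top he₁ he₂ (smallRep_zero_one_of_commute hr hs h hck)
      (smallRep_zero_one_of_commute hr hs h (hinv hck))
      (smallRep_zero_one_of_commute hr hs h hcl)
      (smallRep_zero_one_of_commute hr hs h (hinv hcl))
    have hx : θ.symm (e₂ r s) ∈ S := hS ▸ Algebra.mem_top
    change smallRep hr hs (θ (θ.symm (e₂ r s))) 0 1 = 0 at hx
    rw [θ.apply_symm_apply, smallRep, lift_e₂] at hx
    simp at hx
  have h₁ := (smallRep_zero_one_eq_zero hr hs h (wk hT.hasWeight_b)).resolve_left he₂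
  have h₂ := (smallRep_zero_one_eq_zero hr hs h (wl hT.hasWeight_b)).resolve_left he₂
  push_cast at h₁ h₂
  constructor <;> ext <;> simp only <;> omega

end Torus

/-! ### Images of the generators under an automorphism -/

section Automorphism

variable (hr : r ≠ 0) (hs : s ≠ 0) (h : Generic r s)
include hr hs h

theorem exists_map_k_eq (θ : AugBorel r s ≃ₐ[ℂ] AugBorel r s) : ∃ c d : ℂ, c ≠ 0 ∧ d ≠ 0 ∧
    θ (k₁ r s : AugBorel r s) = c • (k₁ r s : AugBorel r s) ∧
    θ (k₂ r s : AugBorel r s) = d • (k₂ r s : AugBorel r s) := by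
  have hu (u : (AugBorel r s)ˣ) : θ u * θ (u⁻¹ : (AugBorel r s)ˣ) = 1 := by
    rw [← map_mul, Units.mul_inv, map_one]
  obtain ⟨c, p, hc, hk⟩ := eq_smul_torusMon_of_mul_eq_one hr hs h (hu (k₁ r s))
  obtain ⟨d, q, hd, hl⟩ := eq_smul_torusMon_of_mul_eq_one hr hs h (hu (k₂ r s))
  obtain ⟨rfl, rfl⟩ := torusMon_eq_of_algEquiv hr hs h θ hc hd hk hl
  exact ⟨c, d, hc, hd, by simpa [torusMon] using hk, by simpa [torusMon] using hl⟩

omit hr hs h in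
theorem k₁_mul_map (θ : AugBorel r s ≃ₐ[ℂ] AugBorel r s) {c : ℂ} (hc : c ≠ 0)
    (hk : θ (k₁ r s : AugBorel r s) = c • (k₁ r s : AugBorel r s)) {x : AugBorel r s} {χ : ℂ}
    (hx : (k₁ r s : AugBorel r s) * x = χ • (x * k₁ r s)) :
    (k₁ r s : AugBorel r s) * θ x = χ • (θ x * k₁ r s) := by
  have := congrArg θ hx
  rw [map_mul, map_smul, map_mul, hk, smul_mul_assoc, mul_smul_comm, smul_comm] at this
  exact smul_right_injective _ hc this

/-- If all automorphisms map `x` into `x · AugBorel`, they map `x` to a multiple of a product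
of `x` by a torus monomial. -/
theorem exists_map_eq_mul_torusMon {x : AugBorel r s} (hx0 : x ≠ 0)
    (hx : ∀ θ : AugBorel r s ≃ₐ[ℂ] AugBorel r s, ∃ t, θ x = x * t)
    (θ : AugBorel r s ≃ₐ[ℂ] AugBorel r s) : ∃ (c : ℂ) (p : ℤ × ℤ), c ≠ 0 ∧
      θ x = c • (x * torusMon (k₁ r s) (k₂ r s) p) := by
  have := noZeroDivisors hr hs h
  obtain ⟨t, ht⟩ := hx θ
  obtain ⟨t', ht'⟩ := hx θ.symm
  -- Cancelling x in x = θ(θ⁻¹(x)) = x t θ(t') exhibits t as a unit.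
  have h1 : t * θ t' = 1 := by
    have e := θ.apply_symm_apply x
    rw [ht', map_mul, ht, mul_assoc] at e
    have : x * (t * θ t' - 1) = 0 := by rw [mul_sub, e, mul_one, sub_self]
    exact sub_eq_zero.1 ((mul_eq_zero.1 this).resolve_left hx0)
  obtain ⟨c, p, hc, rfl⟩ := eq_smul_torusMon_of_mul_eq_one hr hs h h1
  exact ⟨c, p, hc, by rw [ht, mul_smul_comm]⟩

theorem exists_map_e₁_eq (θ : AugBorel r s ≃ₐ[ℂ] AugBorel r s) : ∃ (c : ℂ) (p : ℤ × ℤ), c ≠ 0 ∧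
    θ (e₁ r s) = c • (e₁ r s * torusMon (k₁ r s) (k₂ r s) p) := by
  refine exists_map_eq_mul_torusMon hr hs h (e₁_ne_zero hr hs h) (fun θ => ?_) θ
  obtain ⟨c, -, hc, -, hk, -⟩ := exists_map_k_eq hr hs h θ
  exact exists_eq_e₁_mul hr hs h (k₁_mul_map θ hc hk (torusAction r s).hasWeight_a.left)

theorem exists_map_e₂_eq (θ : AugBorel r s ≃ₐ[ℂ] AugBorel r s) : ∃ (c : ℂ) (p : ℤ × ℤ), c ≠ 0 ∧
    θ (e₂ r s) = c • (e₂ r s * torusMon (k₁ r s) (k₂ r s) p) := by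
  refine exists_map_eq_mul_torusMon hr hs h (e₂_ne_zero hr hs h) (fun θ => ?_) θ
  obtain ⟨c, -, hc, -, hk, -⟩ := exists_map_k_eq hr hs h θ
  exact exists_eq_e₂_mul hr hs h (k₁_mul_map θ hc hk (torusAction r s).hasWeight_b.left)

/-- Twisting the generators by torus monomials preserves the quantum Serre relation only if the
twists are compatible. -/
theorem chi_eq_of_serrePair {c d : ℂ} {p q : ℤ × ℤ} (hc : c ≠ 0) (hd : d ≠ 0)
    (hS : SerrePair r s (c • (e₁ r s * torusMon (k₁ r s) (k₂ r s) p))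
      (d • (e₂ r s * torusMon (k₁ r s) (k₂ r s) q))) :
    chi₁ r s 0 1 ^ p.1 * chi₂ r s 0 1 ^ p.2 = chi₁ r s 1 0 ^ q.1 * chi₂ r s 1 0 ^ q.2 := by
  have := noZeroDivisors hr hs h
  have := nontrivial hr hs
  have hT := torusAction r s
  set u := chi₁ r s 0 1 ^ p.1 * chi₂ r s 0 1 ^ p.2 with hu
  set v := chi₁ r s 1 0 ^ q.1 * chi₂ r s 1 0 ^ q.2 with hv
  set w := chi₁ r s 0 1 ^ q.1 * chi₂ r s 0 1 ^ q.2 with hw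
  have hv0 : v ≠ 0 :=
    mul_ne_zero (zpow_ne_zero _ (chi₁_ne_zero hr hs)) (zpow_ne_zero _ (chi₂_ne_zero hr hs))
  have hw0 : w ≠ 0 :=
    mul_ne_zero (zpow_ne_zero _ (chi₁_ne_zero hr hs)) (zpow_ne_zero _ (chi₂_ne_zero hr hs))
  have hKb := hT.hasWeight_b.torusMon_mul hr hs p
  have hLa := hT.hasWeight_a.torusMon_mul hr hs q
  have hLb := hT.hasWeight_b.torusMon_mul hr hs q
  rw [← hu] at hKb
  rw [← hv] at hLa
  rw [← hw] at hLb
  have hLK : (torusMon (k₁ r s) (k₂ r s) q : AugBorel r s) * torusMon (k₁ r s) (k₂ r s) p =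
      torusMon (k₁ r s) (k₂ r s) p * torusMon (k₁ r s) (k₂ r s) q := by
    rw [← Units.val_mul, ← Units.val_mul, ← torusMon_mul hT.comm, ← torusMon_mul hT.comm, add_comm]
  set K := torusMon (k₁ r s) (k₂ r s) p
  set L := torusMon (k₁ r s) (k₂ r s) q
  have e₁' := hS.serre_b
  have e₂' := (serrePair r s).serre_b
  set a := e₁ r s
  set b := e₂ r s
  set σ := r ^ (-3 : ℤ) + s ^ (-3 : ℤ) with hσ
  set π := r ^ (-3 : ℤ) * s ^ (-3 : ℤ) with hπ
  -- Moving all torus factors to the right in the twisted relation produces the common scalar w c d²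
  -- and these powers of u and v.
  have e₃ : ((v ^ 2) • (b ^ 2 * a) - (σ * u * v) • (b * a * b) + (π * u ^ 2) • (a * b ^ 2)) *
      ((K * L * L : (AugBorel r s)ˣ) : AugBorel r s) = 0 := by
    rw [← smul_right_injective _ (mul_ne_zero hw0 (mul_ne_zero hc (pow_ne_zero 2 hd)))
      |>.eq_iff, smul_zero, ← e₁']
    simp only [pow_succ, pow_zero, one_mul, Units.val_mul, mul_mul_of_eq hKb,
      mul_mul_of_eq hLa, mul_mul_of_eq hLb, hLK, mul_mul_of_eq hLK, mul_smul_comm,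
      smul_mul_assoc, add_mul (R := AugBorel r s), sub_mul (α := AugBorel r s),
      mul_assoc (G := AugBorel r s)]
    module
  rw [Units.mul_left_eq_zero] at e₃
  -- Subtracting v² times the original Serre relation removes b²a; the remainder is divisible by v −
  -- u and ends in b.
  have e₄ : (v - u) • ((σ * v) • (b * a) - (π * (u + v)) • (a * b)) * b = 0 := by
    simp only [pow_succ, pow_zero, one_mul, sub_mul (α := AugBorel r s), smul_sub, smul_mul_assoc,
      mul_assoc (G := AugBorel r s)] at e₂' e₃ ⊢
    linear_combination (norm := module) (1 : ℂ) • e₃ - (v ^ 2) • e₂'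
  have e₅ := (mul_eq_zero.1 e₄).resolve_right (e₂_ne_zero hr hs h)
  rcases smul_eq_zero.1 e₅ with e₆ | e₆
  · exact (sub_eq_zero.1 e₆).symm
  · have hσv := eq_zero_of_smul_e₂_mul_e₁ hr hs h (sub_eq_zero.1 e₆)
    rcases mul_eq_zero.1 hσv with h0 | h0
    · exfalso
      -- The sum r⁻³ + s⁻³ vanishes only if r³ = −s³, and then r⁶ = s⁶.
      refine h.pow_ne hs (n := 6) (by norm_num) ?_
      rw [hσ, zpow_neg, zpow_neg] at h0
      norm_cast at h0
      field_simp at h0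
      linear_combination (r ^ 3 - s ^ 3) * h0
    · exact absurd h0 hv0

end Automorphism
end TwoParamG2

theorem theorem2p1 (r s : ℂ) (hr : r ≠ 0) (hs : s ≠ 0)
    (hrs : ∀ m n : ℤ, r ^ m * s ^ n = 1 → m = 0 ∧ n = 0)
    (θ : TwoParamG2.AugBorel r s ≃ₐ[ℂ] TwoParamG2.AugBorel r s) :
    ∃ (l₁ l₂ g₁ g₂ : ℂ) (a b c d : ℤ),
      l₁ ≠ 0 ∧ l₂ ≠ 0 ∧ g₁ ≠ 0 ∧ g₂ ≠ 0 ∧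
      c = 3 * b ∧ a + 3 * b + d = 0 ∧
      θ (TwoParamG2.k₁ r s : TwoParamG2.AugBorel r s)
        = l₁ • (TwoParamG2.k₁ r s : TwoParamG2.AugBorel r s) ∧
      θ (TwoParamG2.k₂ r s : TwoParamG2.AugBorel r s)
        = l₂ • (TwoParamG2.k₂ r s : TwoParamG2.AugBorel r s) ∧
      θ (TwoParamG2.e₁ r s)
        = g₁ • (((TwoParamG2.k₁ r s ^ a * TwoParamG2.k₂ r s ^ b :
            (TwoParamG2.AugBorel r s)ˣ) : TwoParamG2.AugBorel r s) * TwoParamG2.e₁ r s) ∧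
      θ (TwoParamG2.e₂ r s)
        = g₂ • (((TwoParamG2.k₁ r s ^ c * TwoParamG2.k₂ r s ^ d :
            (TwoParamG2.AugBorel r s)ˣ) : TwoParamG2.AugBorel r s) * TwoParamG2.e₂ r s) := by
  have h : TwoParamG2.Generic r s := hrs
  have hT := TwoParamG2.torusAction r s
  obtain ⟨l₁, l₂, hl₁, hl₂, hk, hl⟩ := TwoParamG2.exists_map_k_eq hr hs h θ
  obtain ⟨g₁, p, hg₁, he₁⟩ := TwoParamG2.exists_map_e₁_eq hr hs h θ
  obtain ⟨g₂, q, hg₂, he₂⟩ := TwoParamG2.exists_map_e₂_eq hr hs h θ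
  have hS := (TwoParamG2.serrePair r s).map (θ : _ →ₐ[ℂ] TwoParamG2.AugBorel r s)
  simp only [AlgEquiv.coe_toAlgHom, he₁, he₂] at hS
  have hχ := TwoParamG2.chi_eq_of_serrePair hr hs h hg₁ hg₂ hS
  rw [TwoParamG2.chi_zpow_eq hr hs, TwoParamG2.chi_zpow_eq hr hs] at hχ
  -- With p = (a, b) and q = (c, d) the exponents give 3a + 6b = −c − 3d and 3a + 3b = −2c − 3d,
  -- equivalent to the two required conditions.
  have hpq := h.eq_of_zpow_mul_zpow_eq hr hs hχ
  push_cast at hpq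
  -- The torus monomial is moved to the left of the generator at the cost of a nonzero scalar.
  have left {x : TwoParamG2.AugBorel r s} {m n : ℕ} {g : ℂ} (hg : g ≠ 0) (p : ℤ × ℤ)
      (hx : TwoParamG2.HasWeight r s (TwoParamG2.k₁ r s) (TwoParamG2.k₂ r s) x m n) :
      ∃ g' : ℂ, g' ≠ 0 ∧ g • (x * TwoParamG2.torusMon (TwoParamG2.k₁ r s) (TwoParamG2.k₂ r s) p) =
        g' • ((TwoParamG2.torusMon (TwoParamG2.k₁ r s) (TwoParamG2.k₂ r s) p :
          TwoParamG2.AugBorel r s) * x) := by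
    have hne : TwoParamG2.chi₁ r s m n ^ p.1 * TwoParamG2.chi₂ r s m n ^ p.2 ≠ 0 :=
      mul_ne_zero (zpow_ne_zero _ (TwoParamG2.chi₁_ne_zero hr hs))
        (zpow_ne_zero _ (TwoParamG2.chi₂_ne_zero hr hs))
    refine ⟨g * (TwoParamG2.chi₁ r s m n ^ p.1 * TwoParamG2.chi₂ r s m n ^ p.2)⁻¹,
      mul_ne_zero hg (inv_ne_zero hne), ?_⟩
    rw [hx.torusMon_mul hr hs p, smul_smul, inv_mul_cancel_right₀ hne]
  obtain ⟨g₁', hg₁', e₁'⟩ := left hg₁ p hT.hasWeight_a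
  obtain ⟨g₂', hg₂', e₂'⟩ := left hg₂ q hT.hasWeight_b
  refine ⟨l₁, l₂, g₁', g₂', p.1, p.2, q.1, q.2, hl₁, hl₂, hg₁', hg₂', ?_, ?_, hk, hl,
    he₁.trans e₁', he₂.trans e₂'⟩ <;> omega
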